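/- Let $n\ge 1$ be an integer. For $m>1$ let $p_0(m)$ denote the positive root of $(m-1)p^2-(m+1)p-2=0$, and put $$p_2(n)=\max\{p_0(n+2),\,1+2/n\}.$$ Let $1<p\le p_2(n)$. Let $v_0\in C^2_c(\mathbb R^n)$ and $v_1\in C^1_c(\mathbb R^n)$ be real-valued with $v_0\ge 0$, $v_1\ge 0$ and $(v_0,v_1)\not\equiv(0,0)$. Let $T\in(0,\infty]$ and let $v\in C^2([0,T)\times\mathbb R^n)$ be a real-valued classical solution of $$v_{tt}-\Delta v+\frac{2}{1+t}\,v_t=|v|^p\quad\text{on }[0,T)\times\mathbb R^n,\qquad v(0,x)=v_0(x),\quad v_t(0,x)=v_1(x)\quad (x\in\mathbb R^n).$$ Then $T<\infty$. In other words, the Cauchy problem has no global $C^2$ solution, the critical case $p=p_2(n)$ included. -/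

import Mathlib

noncomputable section

/-- The Strauss exponent `p₀(m)`: for `m > 1`, the positive solution `p` of
`(m - 1) p ^ 2 - (m + 1) p - 2 = 0` (see `straussExponent_iff`).
It is only meaningful for `m > 1`. -/
def straussExponent (m : ℝ) : ℝ :=
  ((m + 1) + √((m + 1) ^ 2 + 8 * (m - 1))) / (2 * (m - 1))

/-- For `m > 1`, the Strauss exponent is the unique positive root of its quadratic equation. -/
theorem straussExponent_iff {m : ℝ} (hm : 1 < m) (p : ℝ) :
    (0 < p ∧ (m - 1) * p ^ 2 - (m + 1) * p - 2 = 0) ↔ p = straussExponent m := by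
  have hm' : 0 < m - 1 := by linarith
  have hD : 0 ≤ (m + 1) ^ 2 + 8 * (m - 1) := by positivity
  have hs := Real.sq_sqrt hD
  have hs0 := Real.sqrt_nonneg ((m + 1) ^ 2 + 8 * (m - 1))
  unfold straussExponent
  set s := √((m + 1) ^ 2 + 8 * (m - 1))
  rw [eq_div_iff (by positivity)]
  constructor
  · rintro ⟨hp, h⟩
    have h1 : (2 * (m - 1) * p - (m + 1)) ^ 2 = s ^ 2 := by
      rw [hs]; linear_combination 4 * (m - 1) * h
    have h2 : 0 ≤ 2 * (m - 1) * p - (m + 1) := by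
      by_contra hneg
      nlinarith [mul_pos hm' hp]
    have h3 := (sq_eq_sq₀ h2 hs0).1 h1
    linarith
  · intro h
    have hp : 0 < p := by
      by_contra hneg
      nlinarith
    refine ⟨hp, ?_⟩
    have h1 : 4 * (m - 1) * ((m - 1) * p ^ 2 - (m + 1) * p - 2) = 0 := by
      have h2 : s = 2 * (m - 1) * p - (m + 1) := by linarith
      rw [h2] at hs
      linear_combination hs
    rcases mul_eq_zero.1 h1 with h2 | h2
    · linarith
    · exact h2

/-- The exponent `p₂(n) = max {p₀(n + 2), 1 + 2 / n}`. -/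
def criticalExponent (n : ℕ) : ℝ :=
  max (straussExponent ((n : ℝ) + 2)) (1 + 2 / (n : ℝ))

/-- The time interval `[0, T)`, where `T = ⊤` (that is, `T = ∞`) is allowed. -/
def timeInterval (T : EReal) : Set ℝ := {t : ℝ | 0 ≤ t ∧ (t : EReal) < T}

/-- `v` is a classical solution, of class `C²` on `[0, T) × ℝⁿ`, of
`v_tt - Δ v + 2 / (1 + t) v_t = |v| ^ p` with `v(0, ·) = v₀` and `v_t(0, ·) = v₁`.
Time derivatives are one-sided at `t = 0`. -/
structure IsClassicalSolution (n : ℕ) (p : ℝ) (T : EReal)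
    (v₀ v₁ : EuclideanSpace ℝ (Fin n) → ℝ) (v : ℝ → EuclideanSpace ℝ (Fin n) → ℝ) : Prop where
  contDiffOn : ContDiffOn ℝ 2 (fun z : ℝ × EuclideanSpace ℝ (Fin n) => v z.1 z.2)
    (timeInterval T ×ˢ (Set.univ : Set (EuclideanSpace ℝ (Fin n))))
  equation : ∀ t ∈ timeInterval T, ∀ x : EuclideanSpace ℝ (Fin n),
    iteratedDerivWithin 2 (fun s => v s x) (timeInterval T) t
      - Laplacian.laplacian (v t) x
      + 2 / (1 + t) * derivWithin (fun s => v s x) (timeInterval T) t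
      = |v t x| ^ p
  initial_value : ∀ x, v 0 x = v₀ x
  initial_velocity : ∀ x, derivWithin (fun s => v s x) (timeInterval T) 0 = v₁ x

end

/-! # Blow-up for the scale-invariant damped wave equation

The function `u = (1 + t) v` solves the undamped equation `u_tt - Δ u = F` with
`F = (1 + t) ^ (1 - p) |u| ^ p`, and its data `v₀`, `v₀ + v₁` are nonnegative with nontrivial velocity
(`IsJet.one_add_mul`, `IsConeSolution`). A weighted energy estimate shows that `u` vanishes for
`‖x‖ > t + R` (`IsJet.eq_zero_of_lt_norm`), so that `u` may be tested against functions without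
decay.

The test functions are superpositions over the directions `ω` in the unit sphere of plane waves
`f (t + R + 1 - ⟪x, ω⟫)`. With `U`, `V`, `W` the integrals of `u`, `u` and `F` against the waves of
profile `f`, `f'` and `f`, and `A` the integral of `u_t` minus `V`, the wave equation gives `A' = W`
and `U' = A + 2 V` (`IsJet.hasDerivAt_dual`), while `A 0 > 0` for a positive decreasing profile. If
a quantity `N` satisfies `|U| ≤ C (1 + t) N`, `|V| ≤ C N` and
`N ^ p ≤ C (1 + t) (1 + log (1 + t)) W`, then the mean `Z` of `A` over `[0, R]` with weight
`(θ (1 - θ)) ^ m` satisfies `Z ^ p ≤ C (1 + log R) R Z'`, which is impossible because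
`1 / (R (1 + log R))` is not integrable at infinity (`no_global_averages`). The logarithm is what
makes both critical cases accessible.

The bounds on `N` follow from Hölder's inequality in two regimes, `d` being the dimension.
* If `d (p - 1) ≤ 2`, the constant profile works, with `V = 0`
  (`IsConeSolution.false_of_le_two`).
* If `d ≥ 3` and `p` is at most the Strauss exponent in dimension `d + 2`, the profile
  `(1 + s ^ 2) ^ (-β / 2)` with `β = (d - 1) / 2 - 1 / p` works, and `N` is the pairing of `|u|` with
  the waves of exponent `β + 1`. By the measure of spherical caps these decay like
  `τ ^ (-(d - 1) / 2) (τ - ‖x‖) ^ (-1 / q)` on `‖x‖ ≤ τ - 1`, with `τ = t + R + 1` and `q` the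
  conjugate exponent of `p`, and the `q`-th power of this integrates to a logarithm
  (`exists_integral_planeWave_rpow_le`, `IsConeSolution.false_of_le_strauss`).

These regimes cover `p ≤ p₂(n)`, as above `1 + 2 / n` the Strauss exponent in dimension `n + 2`
matters only for `n ≥ 3`, where it is at most `2` (`three_le_and_le_two`).
-/

namespace DampedWave

open Set Filter Topology MeasureTheory

/-! ### Blow-up for the averaged system -/

/-- If `Z ^ p ≤ C (1 + log R) R Z'` on `[1, ∞)` with `p > 1`, then the positive function `Z`
cannot exist globally: `Z ^ (1 - p)` decreases at least like a multiple of `log (1 + log R)`. -/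
theorem not_rpow_le_log_mul_deriv {p C : ℝ} (hp : 1 < p) (hC : 0 ≤ C) {Z Z' : ℝ → ℝ}
    (hZ : ∀ R, 1 ≤ R → HasDerivAt Z (Z' R) R) (hpos : ∀ R, 1 ≤ R → 0 < Z R)
    (h : ∀ R, 1 ≤ R → Z R ^ p ≤ C * (1 + Real.log R) * (R * Z' R)) : False := by
  have hlog : ∀ R : ℝ, 1 ≤ R → 0 < 1 + Real.log R := fun R hR => by
    have := Real.log_nonneg hR; linarith
  have hmul : ∀ R, 1 ≤ R → 0 < C * (1 + Real.log R) * (R * Z' R) := fun R hR =>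
    (Real.rpow_pos_of_pos (hpos R hR) p).trans_le (h R hR)
  have hC : 0 < C := by
    refine lt_of_le_of_ne hC fun h0 => ?_
    have := hmul 1 le_rfl
    simp [← h0] at this
  have hZ' : ∀ R, 1 ≤ R → 0 < Z' R := fun R hR => by
    have h1 := pos_of_mul_pos_right (hmul R hR) (mul_pos hC (hlog R hR)).le
    exact pos_of_mul_pos_right h1 (by linarith)
  set c := (p - 1) / C with hc
  have hc0 : 0 < c := div_pos (by linarith) hC
  let L : ℝ → ℝ := fun R => Z R ^ (1 - p) + c * Real.log (1 + Real.log R)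
  have hL : ∀ R, 1 ≤ R → HasDerivAt L
      (Z' R * (1 - p) * Z R ^ (1 - p - 1) + c * (R⁻¹ / (1 + Real.log R))) R := by
    intro R hR
    have h1 := (hZ R hR).rpow_const (p := 1 - p) (Or.inl (hpos R hR).ne')
    have h2 := ((Real.hasDerivAt_log (by positivity : R ≠ 0)).const_add 1).log (hlog R hR).ne'
    exact h1.add (h2.const_mul c)
  have hanti : AntitoneOn L (Ici 1) := by
    refine antitoneOn_of_deriv_nonpos (convex_Ici 1)
      (fun R hR => (hL R hR).continuousAt.continuousWithinAt)
      (fun R hR => ?_) (fun R hR => ?_)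
    · rw [interior_Ici] at hR
      exact (hL R hR.le).differentiableAt.differentiableWithinAt
    · rw [interior_Ici] at hR
      have hR1 : (1 : ℝ) ≤ R := hR.le
      have hR0 : 0 < R := by linarith
      rw [(hL R hR1).deriv]
      have hz := hpos R hR1
      have hl := hlog R hR1
      have hz' := hZ' R hR1
      have e1 : Z R ^ (1 - p - 1) = (Z R ^ p)⁻¹ := by
        rw [show 1 - p - 1 = -p by ring, Real.rpow_neg hz.le]
      rw [e1]
      have key : c * (R⁻¹ / (1 + Real.log R)) ≤ (p - 1) * Z' R * (Z R ^ p)⁻¹ := by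
        have e2 : c * (R⁻¹ / (1 + Real.log R))
            = (p - 1) * Z' R * (C * (1 + Real.log R) * (R * Z' R))⁻¹ := by
          rw [hc]; field_simp
        rw [e2]
        exact mul_le_mul_of_nonneg_left (inv_anti₀ (Real.rpow_pos_of_pos hz p) (h R hR1))
          (mul_nonneg (by linarith) hz'.le)
      linarith
  have hlim : Tendsto (fun R => c * Real.log (1 + Real.log R)) atTop atTop :=
    (Real.tendsto_log_atTop.comp (tendsto_atTop_add_const_left _ 1
      Real.tendsto_log_atTop)).const_mul_atTop hc0
  obtain ⟨R, hR, hR1⟩ := ((hlim.eventually_gt_atTop (L 1)).and (eventually_ge_atTop 1)).exists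
  have h1 : L R ≤ L 1 := hanti (mem_Ici.2 le_rfl) hR1 hR1
  have h2 : 0 < Z R ^ (1 - p) := Real.rpow_pos_of_pos (hpos R hR1) _
  simp only [L] at h1 hR
  linarith

/-- The weight `θ ↦ (θ (1 - θ)) ^ m`, vanishing at both ends of `[0, 1]`, and its derivative. -/
theorem hasDerivAt_bump (m : ℕ) (θ : ℝ) :
    HasDerivAt (fun θ : ℝ => (θ * (1 - θ)) ^ m)
      (m * (θ * (1 - θ)) ^ (m - 1) * (1 - 2 * θ)) θ := by
  have h := (((hasDerivAt_id θ).mul ((hasDerivAt_id θ).const_sub 1))).pow m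
  convert! h using 1
  simp; ring_nf; simp

/-- Nonexistence of global solutions of the averaged system. Here `A` is the dual functional of
the wave equation, `U` and `V` the averages of the solution against the test function and its time
derivative, and `W = A'` the average of the nonlinearity. Rescaling `[0, R]` to `[0, 1]` and
averaging `A` against `(θ (1 - θ)) ^ m` gives a function `Z` of the scale `R` to which
`not_rpow_le_log_mul_deriv` applies. -/
theorem no_global_averages {p C : ℝ} (hp : 1 < p) (hC : 0 ≤ C) {A U V W N : ℝ → ℝ}
    (hA : ContinuousOn A (Ici 0)) (hU : ContinuousOn U (Ici 0)) (hV : ContinuousOn V (Ici 0))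
    (hW : ContinuousOn W (Ici 0)) (hA0 : 0 < A 0) (hW0 : ∀ t, 0 ≤ t → 0 ≤ W t)
    (dA : ∀ t, 0 < t → HasDerivAt A (W t) t)
    (dU : ∀ t, 0 < t → HasDerivAt U (A t + 2 * V t) t)
    (hN : ∀ t, 0 < t → 0 ≤ N t)
    (bU : ∀ t, 0 < t → |U t| ≤ C * (1 + t) * N t)
    (bV : ∀ t, 0 < t → |V t| ≤ C * N t)
    (bN : ∀ t, 0 < t → N t ^ p ≤ C * (1 + t) * (1 + Real.log (1 + t)) * W t) : False := by
  obtain ⟨m, hm⟩ := exists_nat_ge ((p + 1) / (p - 1))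
  have hm1 : ((m : ℝ) + 1) / p ≤ (m - 1 : ℝ) := by
    rw [div_le_iff₀ (by linarith)] at hm ⊢
    nlinarith
  have hm2 : (1 : ℝ) ≤ m := by
    have : 1 < (p + 1) / (p - 1) := by rw [lt_div_iff₀ (by linarith)]; linarith
    linarith
  have hm3 : 1 ≤ m := by exact_mod_cast hm2
  let η : ℝ → ℝ := fun θ => (θ * (1 - θ)) ^ m
  let η' : ℝ → ℝ := fun θ => m * (θ * (1 - θ)) ^ (m - 1) * (1 - 2 * θ)
  have dη : ∀ θ, HasDerivAt η (η' θ) θ := hasDerivAt_bump m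
  have hηc : Continuous η := by fun_prop
  have hη'c : Continuous η' := by fun_prop
  have hη0 : ∀ θ ∈ Ioo (0 : ℝ) 1, 0 < η θ := fun θ h =>
    pow_pos (mul_pos h.1 (by linarith [h.2])) m
  -- the pointwise bound `|η'|, η ≲ (θ η) ^ (1 / p)` is what the choice of `m` is for
  have hηb : ∀ θ ∈ Ioo (0 : ℝ) 1, (θ * (1 - θ)) ^ (m - 1) ≤ (θ * η θ) ^ (1 / p) := by
    intro θ h
    have hq0 : 0 < θ * (1 - θ) := mul_pos h.1 (by linarith [h.2])
    have hq1 : θ * (1 - θ) ≤ 1 := by nlinarith [h.1, h.2]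
    calc (θ * (1 - θ)) ^ (m - 1) = (θ * (1 - θ)) ^ (m - 1 : ℝ) := by
          rw [← Real.rpow_natCast, Nat.cast_sub hm3, Nat.cast_one]
      _ ≤ (θ * (1 - θ)) ^ (((m : ℝ) + 1) / p) :=
          Real.rpow_le_rpow_of_exponent_ge hq0 hq1 hm1
      _ = ((θ * (1 - θ)) ^ (m + 1)) ^ (1 / p) := by
          rw [← Real.rpow_natCast, ← Real.rpow_mul hq0.le]; push_cast; ring_nf
      _ ≤ (θ * η θ) ^ (1 / p) := by
          refine Real.rpow_le_rpow (by positivity) ?_ (by positivity)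
          have : (θ * (1 - θ)) ^ (m + 1) = (1 - θ) * (θ * η θ) := by simp only [η]; ring
          rw [this]
          nlinarith [mul_pos h.1 (hη0 θ h), h.1]
  have hηb1 : ∀ θ ∈ Ioo (0 : ℝ) 1, |η' θ| ≤ m * (θ * η θ) ^ (1 / p) := by
    intro θ h
    have hq0 : 0 ≤ (θ * (1 - θ)) ^ (m - 1) := (pow_pos (mul_pos h.1 (by linarith [h.2])) _).le
    simp only [η']
    rw [abs_mul, abs_mul, abs_of_nonneg hq0, Nat.abs_cast]
    have : |1 - 2 * θ| ≤ 1 := by rw [abs_le]; constructor <;> linarith [h.1, h.2]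
    calc _ ≤ m * (θ * (1 - θ)) ^ (m - 1) * 1 := by gcongr
      _ ≤ _ := by rw [mul_one]; gcongr; exact hηb θ h
  have hηb2 : ∀ θ ∈ Ioo (0 : ℝ) 1, η θ ≤ (θ * η θ) ^ (1 / p) := by
    intro θ h
    refine le_trans ?_ (hηb θ h)
    exact pow_le_pow_of_le_one (mul_pos h.1 (by linarith [h.2])).le
      (by nlinarith [h.1, h.2]) (Nat.sub_le m 1)
  let Z : ℝ → ℝ := fun R => ∫ θ in (0 : ℝ)..1, A (R * θ) * η θ
  let Z' : ℝ → ℝ := fun R => ∫ θ in (0 : ℝ)..1, W (R * θ) * θ * η θ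
  have hmaps : ∀ R : ℝ, 0 ≤ R → MapsTo (fun θ => R * θ) (Icc 0 1) (Ici 0) :=
    fun R hR θ hθ => mul_nonneg hR hθ.1
  have hcomp : ∀ {f : ℝ → ℝ}, ContinuousOn f (Ici 0) → ∀ R : ℝ, 0 ≤ R →
      ContinuousOn (fun θ => f (R * θ)) (Icc 0 1) := fun hf R hR =>
    hf.comp (by fun_prop) (hmaps R hR)
  have hAmono : ∀ t, 0 ≤ t → A 0 ≤ A t := by
    have : MonotoneOn A (Ici 0) := by
      refine monotoneOn_of_deriv_nonneg (convex_Ici 0) hA (fun t ht => ?_) (fun t ht => ?_)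
      · rw [interior_Ici] at ht
        exact (dA t ht).differentiableAt.differentiableWithinAt
      · rw [interior_Ici] at ht
        rw [(dA t ht).deriv]
        exact hW0 t ht.le
    exact fun t ht => this (mem_Ici.2 le_rfl) ht ht
  have hZpos : ∀ R, 1 ≤ R → 0 < Z R := by
    intro R hR
    refine intervalIntegral.intervalIntegral_pos_of_pos_on ?_ (fun θ hθ => ?_) one_pos
    · exact ContinuousOn.intervalIntegrable_of_Icc zero_le_one
        ((hcomp hA R (by linarith)).mul hηc.continuousOn)
    · exact mul_pos (hA0.trans_le (hAmono _ (mul_nonneg (by linarith) hθ.1.le))) (hη0 θ hθ)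
  have dZ : ∀ R, 1 ≤ R → HasDerivAt Z (Z' R) R := by
    intro R hR
    have hb : ∃ M, ∀ t ∈ Icc (0 : ℝ) (R + 1), |W t| ≤ M := by
      obtain ⟨M, hM⟩ := isCompact_Icc.exists_bound_of_continuousOn
        (hW.mono (Icc_subset_Ici_self : Icc 0 (R + 1) ⊆ Ici 0))
      exact ⟨M, hM⟩
    obtain ⟨M, hM⟩ := hb
    have hη1 : ∀ θ ∈ Ioc (0 : ℝ) 1, |η θ| ≤ 1 := by
      intro θ h
      have h0 : 0 ≤ θ * (1 - θ) := mul_nonneg h.1.le (by linarith [h.2])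
      rw [abs_of_nonneg (pow_nonneg h0 m)]
      exact pow_le_one₀ h0 (by nlinarith [h.1, h.2])
    refine (intervalIntegral.hasDerivAt_integral_of_dominated_loc_of_deriv_le
      (F := fun R θ => A (R * θ) * η θ) (F' := fun R θ => W (R * θ) * θ * η θ)
      (s := Ioo 0 (R + 1)) (bound := fun _ => M) (Ioo_mem_nhds (by linarith) (by linarith))
      ?_ ?_ ?_ ?_ ?_ ?_).2
    · filter_upwards [Ioi_mem_nhds (show 0 < R by linarith)] with r hr
      rw [uIoc_of_le zero_le_one]
      exact (((hcomp hA r (le_of_lt hr)).mul hηc.continuousOn).mono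
        Ioc_subset_Icc_self).aestronglyMeasurable measurableSet_Ioc
    · exact ContinuousOn.intervalIntegrable_of_Icc zero_le_one
        ((hcomp hA R (by linarith)).mul hηc.continuousOn)
    · rw [uIoc_of_le zero_le_one]
      exact ((((hcomp hW R (by linarith)).mul continuousOn_id).mul hηc.continuousOn).mono
        Ioc_subset_Icc_self).aestronglyMeasurable measurableSet_Ioc
    · refine Eventually.of_forall fun θ hθ r hr => ?_
      rw [uIoc_of_le zero_le_one] at hθ
      have h1 : |W (r * θ)| ≤ M := hM _ ⟨mul_nonneg hr.1.le hθ.1.le, by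
        nlinarith [hr.1, hr.2, hθ.1, hθ.2]⟩
      have h2 : |θ| ≤ 1 := by rw [abs_of_pos hθ.1]; exact hθ.2
      rw [Real.norm_eq_abs, abs_mul, abs_mul]
      have hM0 : 0 ≤ M := (abs_nonneg _).trans h1
      calc |W (r * θ)| * |θ| * |η θ| ≤ M * 1 * 1 := by
            gcongr
            exact hη1 θ hθ
        _ = M := by ring
    · exact intervalIntegrable_const
    · refine Eventually.of_forall fun θ hθ r hr => ?_
      rw [uIoc_of_le zero_le_one] at hθ
      have h1 := (dA (r * θ) (mul_pos hr.1 hθ.1)).comp r ((hasDerivAt_id r).mul_const θ)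
      simpa using h1.mul_const (η θ)
  -- integration by parts in `θ`, using `A = U' - 2 V`
  have hparts : ∀ R, 1 ≤ R → R * Z R
      = ∫ θ in (0 : ℝ)..1, (-(η' θ * U (R * θ)) - 2 * R * (η θ * V (R * θ))) := by
    intro R hR
    have hR0 : 0 < R := by linarith
    have hmR := hmaps R hR0.le
    have i1 : IntervalIntegrable (fun θ => η θ * (R * (A (R * θ) + 2 * V (R * θ)))
        + η' θ * U (R * θ)) volume 0 1 := by
      apply ContinuousOn.intervalIntegrable_of_Icc zero_le_one
      fun_prop (disch := assumption)
    have hftc : ∫ θ in (0 : ℝ)..1, (η θ * (R * (A (R * θ) + 2 * V (R * θ)))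
        + η' θ * U (R * θ)) = η 1 * U (R * 1) - η 0 * U (R * 0) := by
      refine intervalIntegral.integral_eq_sub_of_hasDerivAt_of_le zero_le_one
        (f := fun θ => η θ * U (R * θ)) (hηc.continuousOn.mul (hcomp hU R hR0.le)) (fun θ hθ => ?_) i1
      have h1 := (dU (R * θ) (mul_pos hR0 hθ.1)).comp θ ((hasDerivAt_id θ).const_mul R)
      have h2 := (dη θ).mul h1
      convert! h2 using 1
      simp
      ring
    have hz1 : η 1 = 0 := by simp [η]; omega
    have hz0 : η 0 = 0 := by simp [η]; omega
    rw [hz1, hz0, zero_mul, zero_mul, sub_zero] at hftc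
    have i2 : IntervalIntegrable (fun θ => -(η' θ * U (R * θ)) - 2 * R * (η θ * V (R * θ)))
        volume 0 1 := by
      apply ContinuousOn.intervalIntegrable_of_Icc zero_le_one
      fun_prop (disch := assumption)
    have : R * Z R - ∫ θ in (0 : ℝ)..1, (-(η' θ * U (R * θ)) - 2 * R * (η θ * V (R * θ))) = 0 := by
      refine Eq.trans ?_ hftc
      simp only [Z]
      rw [← intervalIntegral.integral_const_mul, ← intervalIntegral.integral_sub _ i2]
      · congr 1; ext θ; ring
      · apply ContinuousOn.intervalIntegrable_of_Icc zero_le_one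
        fun_prop (disch := assumption)
    linarith
  -- insert the bounds on `U`, `V` and `N`, and use Jensen's inequality for the `p`-th power
  let K : ℝ := (2 * C * (m + 1)) ^ p * (4 * C)
  have hK : 0 ≤ K := by positivity
  refine not_rpow_le_log_mul_deriv hp hK dZ hZpos fun R hR => ?_
  have hR0 : 0 < R := by linarith
  have hlogR := Real.log_nonneg hR
  have hmR := hmaps R hR0.le
  let G : ℝ → ℝ := fun θ => |-(η' θ * U (R * θ)) - 2 * R * (η θ * V (R * θ))|
  have cG : ContinuousOn G (Icc 0 1) := by
    apply ContinuousOn.abs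
    fun_prop (disch := assumption)
  have hG0 : ∀ θ, 0 ≤ G θ := fun θ => abs_nonneg _
  have hGb : ∀ θ ∈ Ioo (0 : ℝ) 1,
      G θ ^ p ≤ R ^ p * (K * (1 + Real.log R) * (R * (W (R * θ) * θ * η θ))) := by
    intro θ hθ
    have ht : 0 < R * θ := mul_pos hR0 hθ.1
    have htR : R * θ ≤ R := by nlinarith [hθ.2]
    set X := (θ * η θ) ^ (1 / p) with hX
    have hθη : 0 < θ * η θ := mul_pos hθ.1 (hη0 θ hθ)
    have hX0 : 0 ≤ X := by positivity
    have hn := hN _ ht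
    have h1 : G θ ≤ R * (2 * C * (m + 1)) * X * N (R * θ) := by
      calc G θ ≤ |η' θ| * |U (R * θ)| + 2 * R * (|η θ| * |V (R * θ)|) := by
            refine (abs_sub _ _).trans (le_of_eq ?_)
            rw [abs_neg, abs_mul (η' θ), abs_mul (2 * R), abs_mul (η θ),
              abs_of_pos (by positivity : 0 < 2 * R)]
        _ ≤ m * X * (C * (2 * R) * N (R * θ)) + 2 * R * (X * (C * N (R * θ))) := by
            have := hηb2 θ hθ
            have e := abs_of_pos (hη0 θ hθ)
            gcongr
            · exact hηb1 θ hθ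
            · refine (bU _ ht).trans ?_
              gcongr
              linarith
            · rw [e]; exact this
            · exact bV _ ht
        _ = _ := by ring
    have h2 : X ^ p = θ * η θ := by
      rw [hX, ← Real.rpow_mul hθη.le, one_div_mul_cancel (by linarith), Real.rpow_one]
    have h3 : N (R * θ) ^ p ≤ 4 * C * (1 + Real.log R) * (R * W (R * θ)) := by
      refine (bN _ ht).trans ?_
      have h4 : Real.log (1 + R * θ) ≤ 1 + Real.log R := by
        calc Real.log (1 + R * θ) ≤ Real.log (2 * R) := by
              apply Real.log_le_log <;> linarith
          _ = Real.log 2 + Real.log R := Real.log_mul (by norm_num) hR0.ne'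
          _ ≤ _ := by
            have := Real.log_two_lt_d9
            linarith
      have hw := hW0 _ ht.le
      have h5 : C * (1 + R * θ) * (1 + Real.log (1 + R * θ))
          ≤ C * (2 * R) * (2 * (1 + Real.log R)) := by
        gcongr
        · have := Real.log_nonneg (show 1 ≤ 1 + R * θ by linarith)
          linarith
        · linarith
        · linarith
      calc _ ≤ C * (2 * R) * (2 * (1 + Real.log R)) * W (R * θ) := by gcongr
        _ = _ := by ring
    calc G θ ^ p ≤ (R * (2 * C * (m + 1)) * X * N (R * θ)) ^ p :=
          Real.rpow_le_rpow (hG0 θ) h1 (by linarith)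
      _ = R ^ p * (2 * C * (m + 1)) ^ p * (θ * η θ) * N (R * θ) ^ p := by
          rw [Real.mul_rpow (by positivity) hn, Real.mul_rpow (by positivity) hX0, h2,
            Real.mul_rpow hR0.le (by positivity)]
      _ ≤ R ^ p * (2 * C * (m + 1)) ^ p * (θ * η θ)
            * (4 * C * (1 + Real.log R) * (R * W (R * θ))) := by gcongr
      _ = _ := by simp only [K]; ring
  have hle : R * Z R ≤ ∫ θ in (0 : ℝ)..1, G θ := by
    rw [hparts R hR]
    refine intervalIntegral.integral_mono_on zero_le_one ?_ ?_ fun θ _ => le_abs_self _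
    · apply ContinuousOn.intervalIntegrable_of_Icc zero_le_one
      fun_prop (disch := assumption)
    · exact cG.intervalIntegrable_of_Icc zero_le_one
  have hprob : IsProbabilityMeasure (volume.restrict (Ioc (0 : ℝ) 1)) := ⟨by simp⟩
  have cGp : ContinuousOn (fun θ => G θ ^ p) (Icc 0 1) :=
    cG.rpow_const fun θ _ => Or.inr (by linarith)
  have hjensen : (∫ θ in (0 : ℝ)..1, G θ) ^ p ≤ ∫ θ in (0 : ℝ)..1, G θ ^ p := by
    rw [intervalIntegral.integral_of_le zero_le_one, intervalIntegral.integral_of_le zero_le_one]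
    refine (convexOn_rpow hp.le).map_integral_le
      (Real.continuous_rpow_const (by linarith)).continuousOn isClosed_Ici
      (Eventually.of_forall hG0) ?_ ?_
    · exact (cG.integrableOn_Icc).mono_set Ioc_subset_Icc_self
    · exact (cGp.integrableOn_Icc).mono_set Ioc_subset_Icc_self
  have hfin : ∫ θ in (0 : ℝ)..1, G θ ^ p
      ≤ ∫ θ in (0 : ℝ)..1, R ^ p * (K * (1 + Real.log R) * (R * (W (R * θ) * θ * η θ))) := by
    refine intervalIntegral.integral_mono_on_of_le_Ioo zero_le_one
      (cGp.intervalIntegrable_of_Icc zero_le_one) ?_ hGb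
    apply ContinuousOn.intervalIntegrable_of_Icc zero_le_one
    fun_prop (disch := assumption)
  have hZp : (R * Z R) ^ p ≤ R ^ p * (K * (1 + Real.log R) * (R * Z' R)) := by
    refine (Real.rpow_le_rpow (mul_pos hR0 (hZpos R hR)).le hle (by linarith)).trans
      (hjensen.trans (hfin.trans (le_of_eq ?_)))
    rw [intervalIntegral.integral_const_mul, intervalIntegral.integral_const_mul,
      intervalIntegral.integral_const_mul]
  rw [Real.mul_rpow hR0.le (hZpos R hR).le] at hZp
  exact le_of_mul_le_mul_left hZp (Real.rpow_pos_of_pos hR0 p)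

/-! ### Integrals of compactly supported functions -/

section ParametricIntegral

theorem continuous_slice {X : Type*} [TopologicalSpace X] {k : ℝ → X → ℝ} {s : Set ℝ}
    (hk : ContinuousOn (fun z : ℝ × X => k z.1 z.2) (s ×ˢ univ)) {t : ℝ} (ht : t ∈ s) :
    Continuous (k t) := by
  have : ContinuousOn (fun x : X => k t x) univ :=
    hk.comp (f := fun x : X => (t, x)) (by fun_prop) fun x _ => ⟨ht, mem_univ x⟩
  exact continuousOn_univ.1 this

variable {X : Type*} [TopologicalSpace X] [MeasurableSpace X] [OpensMeasurableSpace X]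
  {μ : Measure X} [IsFiniteMeasureOnCompacts μ]

theorem integrable_of_continuous_of_compact [T2Space X] {g : X → ℝ} {K : Set X} (hg : Continuous g)
    (hK : IsCompact K) (h : ∀ x, x ∉ K → g x = 0) : Integrable g μ :=
  hg.integrable_of_hasCompactSupport (HasCompactSupport.intro hK h)

/-- Differentiation under the integral sign when the integrand is supported in a fixed compact
set of the space variable. -/
theorem hasDerivAt_integral_of_compact [T2Space X] {k k' : ℝ → X → ℝ} {K : Set X} (hK : IsCompact K)
    {a b t : ℝ} (ht : t ∈ Ioo a b)
    (hk : ContinuousOn (fun z : ℝ × X => k z.1 z.2) (Ioo a b ×ˢ univ))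
    (hk' : ContinuousOn (fun z : ℝ × X => k' z.1 z.2) (Ioo a b ×ˢ univ))
    (hd : ∀ s ∈ Ioo a b, ∀ x, HasDerivAt (fun s => k s x) (k' s x) s)
    (hsupp : ∀ s ∈ Ioo a b, ∀ x, x ∉ K → k s x = 0) :
    HasDerivAt (fun s => ∫ x, k s x ∂μ) (∫ x, k' t x ∂μ) t := by
  have hsupp' : ∀ s ∈ Ioo a b, ∀ x, x ∉ K → k' s x = 0 := by
    intro s hs x hx
    refine (hd s hs x).unique ((hasDerivAt_const s (0 : ℝ)).congr_of_eventuallyEq ?_)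
    filter_upwards [isOpen_Ioo.mem_nhds hs] with r hr using hsupp r hr x hx
  obtain ⟨c, hac, hct⟩ := exists_between ht.1
  obtain ⟨d, htd, hdb⟩ := exists_between ht.2
  have hsub : Icc c d ⊆ Ioo a b := fun s hs => ⟨hac.trans_le hs.1, hs.2.trans_lt hdb⟩
  obtain ⟨M, hM⟩ := (isCompact_Icc.prod hK).exists_bound_of_continuousOn
    (hk'.mono (prod_mono hsub (subset_univ K)))
  refine (hasDerivAt_integral_of_dominated_loc_of_deriv_le (F := k) (F' := k')
    (bound := K.indicator fun _ => M) (Icc_mem_nhds hct htd) ?_ ?_ ?_ ?_ ?_ ?_).2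
  · filter_upwards [isOpen_Ioo.mem_nhds ht] with s hs
    exact (continuous_slice hk hs).aestronglyMeasurable
  · exact integrable_of_continuous_of_compact (continuous_slice hk ht) hK (hsupp t ht)
  · exact (continuous_slice hk' ht).aestronglyMeasurable
  · refine Eventually.of_forall fun x s hs => ?_
    by_cases hx : x ∈ K
    · rw [indicator_of_mem hx]
      exact hM (s, x) ⟨hs, hx⟩
    · rw [indicator_of_notMem hx, hsupp' s (hsub hs) x hx, norm_zero]
  · exact (integrable_indicator_iff hK.measurableSet).2
      (integrableOn_const hK.measure_lt_top.ne)
  · exact Eventually.of_forall fun x s hs => hd s (hsub hs) x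

/-- Continuity on `[0, ∞)` of a parametric integral whose integrand is, for bounded times,
supported in a compact set. -/
theorem continuousOn_integral_of_compact {k : ℝ → X → ℝ}
    (hk : ContinuousOn (fun z : ℝ × X => k z.1 z.2) (Ici 0 ×ˢ univ)) {K : ℝ → Set X}
    (hK : ∀ T, IsCompact (K T)) (hsupp : ∀ T, ∀ s ∈ Icc 0 T, ∀ x, x ∉ K T → k s x = 0) :
    ContinuousOn (fun s => ∫ x, k s x ∂μ) (Ici 0) := by
  have h : ∀ T, ContinuousOn (fun s => ∫ x, k s x ∂μ) (Icc 0 T) := fun T =>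
    continuousOn_integral_of_compact_support (hK T)
      (hk.mono (prod_mono Icc_subset_Ici_self Subset.rfl))
      fun s x hs hx => hsupp T s hs x hx
  intro t ht
  refine (h (t + 1) t ⟨ht, by linarith⟩).mono_of_mem_nhdsWithin ?_
  filter_upwards [self_mem_nhdsWithin,
    mem_nhdsWithin_of_mem_nhds (Iio_mem_nhds (show t < t + 1 by linarith))] with s h1 h2
  exact ⟨h1, le_of_lt h2⟩

end ParametricIntegral

theorem integral_lineDeriv_eq_zero {E : Type*} [NormedAddCommGroup E] [InnerProductSpace ℝ E]
    [FiniteDimensional ℝ E] [MeasurableSpace E] [BorelSpace E] {k k' : E → ℝ} {v : E} (hk : Continuous k)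
    (hk' : Continuous k') {K : Set E} (hK : IsCompact K) (hsupp : ∀ x, x ∉ K → k x = 0)
    (hd : ∀ x, HasLineDerivAt ℝ k (k' x) x v) : ∫ x, k' x = 0 := by
  have hsupp' : ∀ x, x ∉ K → k' x = 0 := by
    intro x hx
    have h0 : HasLineDerivAt ℝ (fun _ : E => (0 : ℝ)) 0 x v :=
      hasDerivAt_const (0 : ℝ) (0 : ℝ)
    refine (hd x).unique (h0.congr_of_eventuallyEq ?_)
    filter_upwards [hK.isClosed.isOpen_compl.mem_nhds hx] with y hy using hsupp y hy
  have h := integral_bilinear_hasLineDerivAt_right_eq_neg_left_of_integrable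
    (μ := (volume : Measure E)) (f := fun _ : E => (1 : ℝ)) (f' := fun _ => 0) (g := k) (g' := k')
    (v := v) (B := ContinuousLinearMap.mul ℝ ℝ) (by simp)
    (by simpa using integrable_of_continuous_of_compact hk' hK hsupp')
    (by simpa using integrable_of_continuous_of_compact hk hK hsupp)
    (fun x _ => hasDerivAt_const (0 : ℝ) (1 : ℝ)) (fun x _ => hd x)
  simpa using h

section Jet

variable {ι E : Type*} [Fintype ι] [NormedAddCommGroup E] [InnerProductSpace ℝ E]

/-! ### Jets of functions of class `C²` on `[0, ∞) × E` -/

/-- The functions `ut, utt` (time), `ux i, uxx i` (in the direction `b i`) and `uxt i` (mixed) are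
the derivatives up to order two of `u`: those of order at most one are continuous up to `t = 0`,
those of order two for `t > 0`. -/
structure IsJet (b : OrthonormalBasis ι ℝ E) (u ut utt : ℝ → E → ℝ) (ux uxt uxx : ι → ℝ → E → ℝ) :
    Prop where
  cont_u : ContinuousOn (fun z : ℝ × E => u z.1 z.2) (Ici 0 ×ˢ univ)
  cont_ut : ContinuousOn (fun z : ℝ × E => ut z.1 z.2) (Ici 0 ×ˢ univ)
  cont_ux : ∀ i, ContinuousOn (fun z : ℝ × E => ux i z.1 z.2) (Ici 0 ×ˢ univ)
  cont_utt : ContinuousOn (fun z : ℝ × E => utt z.1 z.2) (Ioi 0 ×ˢ univ)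
  cont_uxt : ∀ i, ContinuousOn (fun z : ℝ × E => uxt i z.1 z.2) (Ioi 0 ×ˢ univ)
  cont_uxx : ∀ i, ContinuousOn (fun z : ℝ × E => uxx i z.1 z.2) (Ioi 0 ×ˢ univ)
  deriv_u : ∀ t, 0 < t → ∀ x, HasDerivAt (fun s => u s x) (ut t x) t
  deriv_ut : ∀ t, 0 < t → ∀ x, HasDerivAt (fun s => ut s x) (utt t x) t
  deriv_ux : ∀ i t, 0 < t → ∀ x, HasDerivAt (fun s => ux i s x) (uxt i t x) t
  line_u : ∀ i t, 0 ≤ t → ∀ x, HasLineDerivAt ℝ (u t) (ux i t x) x (b i)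
  line_ut : ∀ i t, 0 < t → ∀ x, HasLineDerivAt ℝ (ut t) (uxt i t x) x (b i)
  line_ux : ∀ i t, 0 < t → ∀ x, HasLineDerivAt ℝ (ux i t) (uxx i t x) x (b i)

theorem exists_isJet [FiniteDimensional ℝ E] (b : OrthonormalBasis ι ℝ E) {v : ℝ → E → ℝ}
    (hv : ContDiffOn ℝ 2 (fun z : ℝ × E => v z.1 z.2) (Ici 0 ×ˢ univ)) :
    ∃ (vt vtt : ℝ → E → ℝ) (vx vxt vxx : ι → ℝ → E → ℝ), IsJet b v vt vtt vx vxt vxx ∧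
      (∀ t, 0 ≤ t → ∀ x, derivWithin (fun s => v s x) (Ici 0) t = vt t x) ∧
      (∀ t, 0 < t → ∀ x, iteratedDerivWithin 2 (fun s => v s x) (Ici 0) t = vtt t x) ∧
      (∀ t, 0 < t → ∀ x, Laplacian.laplacian (v t) x = ∑ i, vxx i t x) := by
  set S : Set (ℝ × E) := Ici 0 ×ˢ univ with hS
  set Ω : Set (ℝ × E) := Ioi 0 ×ˢ univ with hΩ
  have hΩo : IsOpen Ω := isOpen_Ioi.prod isOpen_univ
  have hΩS : Ω ⊆ S := prod_mono Ioi_subset_Ici_self Subset.rfl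
  have hSu : UniqueDiffOn ℝ S := (uniqueDiffOn_Ici 0).prod uniqueDiffOn_univ
  set V : ℝ × E → ℝ := fun z => v z.1 z.2 with hV
  set D : ℝ × E → (ℝ × E →L[ℝ] ℝ) := fderivWithin ℝ V S with hD
  have hD1 : ContDiffOn ℝ 1 D S := hv.fderivWithin hSu (by norm_num)
  have hSn : ∀ z ∈ Ω, S ∈ 𝓝 z := fun z hz => mem_of_superset (hΩo.mem_nhds hz) hΩS
  have hVd : ∀ z ∈ S, HasFDerivWithinAt V (D z) S z := fun z hz =>
    ((hv.differentiableOn (by norm_num)) z hz).hasFDerivWithinAt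
  have hVΩ : ∀ z ∈ Ω, HasFDerivAt V (D z) z := fun z hz =>
    (hVd z (hΩS hz)).hasFDerivAt (hSn z hz)
  set D2 : ℝ × E → (ℝ × E →L[ℝ] ℝ × E →L[ℝ] ℝ) := fderiv ℝ D with hD2
  have hDΩ : ∀ z ∈ Ω, HasFDerivAt D (D2 z) z := fun z hz =>
    ((hD1.contDiffAt (hSn z hz)).differentiableAt (by norm_num)).hasFDerivAt
  have hD2c : ContinuousOn D2 Ω := ((hD1.mono hΩS).continuousOn_fderiv_of_isOpen hΩo le_rfl)
  have hsymm : ∀ z ∈ Ω, ∀ a c, D2 z a c = D2 z c a := by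
    intro z hz a c
    have h1 := (hv.contDiffAt (hSn z hz)).isSymmSndFDerivAt (by simp)
    have h2 : D2 z = fderiv ℝ (fderiv ℝ V) z := by
      refine Filter.EventuallyEq.fderiv_eq ?_
      filter_upwards [hΩo.mem_nhds hz] with y hy using (hVΩ y hy).fderiv.symm
    rw [h2]
    exact h1 a c
  have hcurve : ∀ t x, HasDerivAt (fun s : ℝ => (s, x)) ((1 : ℝ), (0 : E)) t := fun t x =>
    (hasDerivAt_id t).prodMk (hasDerivAt_const t x)
  have hline : ∀ t (x w : E), HasDerivAt (fun s : ℝ => (t, x + s • w)) ((0 : ℝ), w) 0 := by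
    intro t x w
    have h := ((hasDerivAt_id (0 : ℝ)).smul_const w).const_add x
    simpa using (hasDerivAt_const (0 : ℝ) t).prodMk h
  have hderivW : ∀ t, 0 ≤ t → ∀ x,
      HasDerivWithinAt (fun s => v s x) (D (t, x) (1, 0)) (Ici 0) t := by
    intro t ht x
    exact HasFDerivWithinAt.comp_hasDerivWithinAt (f := fun s : ℝ => (s, x)) t
      (hVd (t, x) ⟨ht, mem_univ x⟩) (hcurve t x).hasDerivWithinAt fun s hs => ⟨hs, mem_univ x⟩
  have hDw : ∀ z ∈ Ω, ∀ w,
      HasFDerivAt (fun z => D z w) ((ContinuousLinearMap.apply ℝ ℝ w).comp (D2 z)) z :=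
    fun z hz w => ((ContinuousLinearMap.apply ℝ ℝ w).hasFDerivAt).comp z (hDΩ z hz)
  have hDt : ∀ t, 0 < t → ∀ x w,
      HasDerivAt (fun s => D (s, x) w) (D2 (t, x) (1, 0) w) t := by
    intro t ht x w
    exact HasFDerivAt.comp_hasDerivAt (f := fun s : ℝ => (s, x)) t
      (hDw (t, x) ⟨ht, mem_univ x⟩ w) (hcurve t x)
  have hDx : ∀ t, 0 < t → ∀ x w y,
      HasLineDerivAt ℝ (fun x => D (t, x) w) (D2 (t, x) (0, y) w) x y := by
    intro t ht x w y
    exact HasFDerivAt.comp_hasDerivAt_of_eq (f := fun s : ℝ => (t, x + s • y)) 0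
      (hDw (t, x) ⟨ht, mem_univ x⟩ w) (hline t x y) (by simp)
  refine ⟨fun t x => D (t, x) (1, 0), fun t x => D2 (t, x) (1, 0) (1, 0),
    fun i t x => D (t, x) (0, b i), fun i t x => D2 (t, x) (1, 0) (0, b i),
    fun i t x => D2 (t, x) (0, b i) (0, b i), ?_, ?_, ?_, ?_⟩
  · refine ⟨hv.continuousOn, hD1.continuousOn.clm_apply continuousOn_const,
      fun i => hD1.continuousOn.clm_apply continuousOn_const,
      (hD2c.clm_apply continuousOn_const).clm_apply continuousOn_const,
      fun i => (hD2c.clm_apply continuousOn_const).clm_apply continuousOn_const,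
      fun i => (hD2c.clm_apply continuousOn_const).clm_apply continuousOn_const,
      fun t ht x => HasFDerivAt.comp_hasDerivAt (f := fun s : ℝ => (s, x)) t
        (hVΩ (t, x) ⟨ht, mem_univ x⟩) (hcurve t x),
      fun t ht x => hDt t ht x _, fun i t ht x => hDt t ht x _, ?_, ?_,
      fun i t ht x => hDx t ht x _ _⟩
    · intro i t ht x
      have h := HasFDerivWithinAt.comp_hasDerivWithinAt_of_eq (s := univ)
        (f := fun s : ℝ => (t, x + s • b i)) (0 : ℝ) (hVd (t, x) ⟨ht, mem_univ x⟩)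
        (hline t x (b i)).hasDerivWithinAt (fun s _ => ⟨ht, mem_univ _⟩) (by simp)
      exact h.hasDerivAt univ_mem
    · intro i t ht x
      rw [hsymm (t, x) ⟨ht, mem_univ x⟩]
      exact hDx t ht x _ _
  · exact fun t ht x => (hderivW t ht x).derivWithin (uniqueDiffOn_Ici 0 t ht)
  · intro t ht x
    rw [iteratedDerivWithin_succ]
    rw [derivWithin_congr (f := fun s => D (s, x) (1, 0))]
    · exact (hDt t ht x _).hasDerivWithinAt.derivWithin (uniqueDiffOn_Ici 0 t ht.le)
    · intro s hs
      rw [iteratedDerivWithin_one]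
      exact (hderivW s hs x).derivWithin (uniqueDiffOn_Ici 0 s hs)
    · rw [iteratedDerivWithin_one]
      exact (hderivW t ht.le x).derivWithin (uniqueDiffOn_Ici 0 t ht.le)
  · intro t ht x
    rw [InnerProductSpace.laplacian_eq_iteratedFDeriv_orthonormalBasis (v t) b]
    refine Finset.sum_congr rfl fun i _ => ?_
    rw [iteratedFDeriv_two_apply]
    have hin : ∀ y, HasFDerivAt (fun x : E => (t, x)) (ContinuousLinearMap.inr ℝ ℝ E) y :=
      fun y => hasFDerivAt_prodMk_right t y
    have h1 : fderiv ℝ (v t) = fun y => (D (t, y)).comp (ContinuousLinearMap.inr ℝ ℝ E) := by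
      ext1 y
      exact ((hVΩ (t, y) ⟨ht, mem_univ y⟩).comp y (hin y)).fderiv
    rw [h1]
    have h2 := (((ContinuousLinearMap.compL ℝ E (ℝ × E) ℝ).flip
      (ContinuousLinearMap.inr ℝ ℝ E)).hasFDerivAt.comp x
        ((hDΩ (t, x) ⟨ht, mem_univ x⟩).comp x (hin x)))
    have h3 := h2.fderiv
    simp only [Function.comp_def, ContinuousLinearMap.flip_apply,
      ContinuousLinearMap.compL_apply] at h3
    rw [h3]
    simp

end Jet

/-! ### Finite speed of propagation -/

section FiniteSpeed

theorem hasDerivAt_max_zero_sq (s : ℝ) :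
    HasDerivAt (fun s : ℝ => max s 0 ^ 2) (2 * max s 0) s := by
  rcases lt_trichotomy s 0 with h | h | h
  · rw [max_eq_right h.le, mul_zero]
    refine (hasDerivAt_const s (0 : ℝ)).congr_of_eventuallyEq ?_
    filter_upwards [Iio_mem_nhds h] with r hr
    simp [show r ≤ 0 from le_of_lt hr]
  · subst h
    have hO : (fun s : ℝ => max s 0 ^ 2) =O[𝓝 0] fun s => ‖s - 0‖ ^ 2 := by
      refine Asymptotics.IsBigO.of_bound 1 (Eventually.of_forall fun r => ?_)
      rw [sub_zero, one_mul, norm_pow, norm_pow, norm_norm]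
      refine pow_le_pow_left₀ (norm_nonneg _) ?_ 2
      rw [Real.norm_eq_abs, Real.norm_eq_abs, abs_of_nonneg (le_max_right r 0)]
      exact max_le (le_abs_self r) (abs_nonneg r)
    simpa using (hO.hasFDerivAt one_lt_two).hasDerivAt
  · rw [max_eq_left h.le]
    have h2 : HasDerivAt (fun s : ℝ => s ^ 2) (2 * s) s := by simpa using hasDerivAt_pow 2 s
    refine h2.congr_of_eventuallyEq ?_
    filter_upwards [Ioi_mem_nhds h] with r hr
    rw [max_eq_left (show 0 ≤ r from le_of_lt hr)]

variable {ι E : Type*} [Fintype ι] [NormedAddCommGroup E]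

/-- The defining function of the backward light cone with vertex `(t₀, x₀)`. -/
def coneFun (t₀ : ℝ) (x₀ : E) (t : ℝ) (x : E) : ℝ := (t₀ - t) ^ 2 - ‖x - x₀‖ ^ 2

theorem continuous_coneFun (t₀ : ℝ) (x₀ : E) :
    Continuous fun z : ℝ × E => coneFun t₀ x₀ z.1 z.2 := by
  unfold coneFun; fun_prop

theorem hasDerivAt_coneFun (t₀ : ℝ) (x₀ : E) (t : ℝ) (x : E) :
    HasDerivAt (fun t => max (coneFun t₀ x₀ t x) 0 ^ 2)
      (2 * max (coneFun t₀ x₀ t x) 0 * (-(2 * (t₀ - t)))) t := by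
  have h : HasDerivAt (fun t => coneFun t₀ x₀ t x) (-(2 * (t₀ - t))) t := by
    have h1 := (((hasDerivAt_id t).const_sub t₀).pow 2).sub_const (‖x - x₀‖ ^ 2)
    convert! h1 using 1
    simp
  exact (hasDerivAt_max_zero_sq _).comp t h

theorem coneFun_nonpos_of_notMem {t₀ T : ℝ} (x₀ : E) {t : ℝ} (ht : |t₀ - t| ≤ T) {x : E}
    (hx : x ∉ Metric.closedBall x₀ T) : coneFun t₀ x₀ t x ≤ 0 := by
  rw [Metric.mem_closedBall, dist_eq_norm, not_le] at hx
  have h : |t₀ - t| ^ 2 ≤ ‖x - x₀‖ ^ 2 := by gcongr; linarith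
  rw [sq_abs] at h
  unfold coneFun
  linarith

variable [InnerProductSpace ℝ E]

theorem hasLineDerivAt_coneFun (t₀ : ℝ) (x₀ : E) (t : ℝ) (x y : E) :
    HasLineDerivAt ℝ (fun x => max (coneFun t₀ x₀ t x) 0 ^ 2)
      (2 * max (coneFun t₀ x₀ t x) 0 * (-(2 * inner ℝ (x - x₀) y))) x y := by
  have h0 : HasDerivAt (fun s : ℝ => x + s • y - x₀) y 0 := by
    simpa using (((hasDerivAt_id (0 : ℝ)).smul_const y).const_add x).sub_const x₀
  have h : HasDerivAt (fun s : ℝ => coneFun t₀ x₀ t (x + s • y)) (-(2 * inner ℝ (x - x₀) y)) 0 := by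
    simpa [coneFun] using h0.norm_sq.const_sub ((t₀ - t) ^ 2)
  have h2 := (hasDerivAt_max_zero_sq (coneFun t₀ x₀ t (x + (0 : ℝ) • y))).comp (0 : ℝ) h
  simpa [HasLineDerivAt, Function.comp_def] using h2

variable [FiniteDimensional ℝ E] [MeasurableSpace E] [BorelSpace E]

/-- Finite speed of propagation for `u_tt - Δ u = F` with `|F| ≲ |u|` locally. The energy
`½ (u_t ^ 2 + |∇ u| ^ 2 + u ^ 2)`, weighted by the square of the positive part of the defining
function of a backward light cone, satisfies a Gronwall inequality and vanishes initially. -/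
theorem IsJet.eq_zero_of_lt_norm {b : OrthonormalBasis ι ℝ E} {u ut utt F : ℝ → E → ℝ}
    {ux uxt uxx : ι → ℝ → E → ℝ} (hj : IsJet b u ut utt ux uxt uxx)
    (eqn : ∀ t, 0 < t → ∀ x, utt t x = ∑ i, uxx i t x + F t x)
    (hF : ∀ T, ∃ M, ∀ t ∈ Ioc 0 T, ∀ x, ‖x‖ ≤ T → |F t x| ≤ M * |u t x|) {R₀ : ℝ}
    (h0 : ∀ x, R₀ < ‖x‖ → u 0 x = 0) (h1 : ∀ x, R₀ < ‖x‖ → ut 0 x = 0)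
    {τ : ℝ} (hτ : 0 ≤ τ) {x₀ : E} (hx₀ : τ + R₀ < ‖x₀‖) : u τ x₀ = 0 := by
  set t₀ := ‖x₀‖ - R₀ with ht₀
  have hτt : τ < t₀ := by linarith
  have ht₀0 : 0 < t₀ := by linarith
  obtain ⟨M₀, hM₀⟩ := hF (‖x₀‖ + t₀)
  set M := max M₀ 0
  have hM0 : 0 ≤ M := le_max_right _ _
  have hM : ∀ t ∈ Ioo 0 t₀, ∀ x ∈ Metric.closedBall x₀ t₀, |F t x| ≤ M * |u t x| := by
    intro t ht x hx
    have h2 : ‖x‖ ≤ ‖x₀‖ + t₀ := by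
      rw [Metric.mem_closedBall, dist_eq_norm] at hx
      calc ‖x‖ = ‖x₀ + (x - x₀)‖ := by congr 1; abel
        _ ≤ ‖x₀‖ + ‖x - x₀‖ := norm_add_le _ _
        _ ≤ _ := by linarith
    refine (hM₀ t ⟨ht.1, ?_⟩ x h2).trans ?_
    · have := norm_nonneg x₀
      linarith [ht.2]
    · exact mul_le_mul_of_nonneg_right (le_max_left _ _) (abs_nonneg _)
  let m : ℝ → E → ℝ := fun t x => max (coneFun t₀ x₀ t x) 0
  have hmc : Continuous fun z : ℝ × E => m z.1 z.2 :=
    (continuous_coneFun t₀ x₀).max continuous_const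
  have hm0 : ∀ t x, 0 ≤ m t x := fun t x => le_max_right _ _
  let e : ℝ → E → ℝ := fun t x => (ut t x ^ 2 + ∑ i, ux i t x ^ 2 + u t x ^ 2) / 2
  have he0 : ∀ t x, 0 ≤ e t x := fun t x => by positivity
  let k : ℝ → E → ℝ := fun t x => e t x * m t x ^ 2
  let k' : ℝ → E → ℝ := fun t x =>
    (ut t x * utt t x + ∑ i, ux i t x * uxt i t x + u t x * ut t x) * m t x ^ 2
      + e t x * (2 * m t x * (-(2 * (t₀ - t))))
  let g : ι → ℝ → E → ℝ := fun i t x => ut t x * ux i t x * m t x ^ 2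
  let g' : ι → ℝ → E → ℝ := fun i t x => (uxt i t x * ux i t x + ut t x * uxx i t x) * m t x ^ 2
      + ut t x * ux i t x * (2 * m t x * (-(2 * inner ℝ (x - x₀) (b i))))
  have hk0 : ∀ t x, 0 ≤ k t x := fun t x => mul_nonneg (he0 t x) (sq_nonneg _)
  have hsub : (Ioi (0 : ℝ) ×ˢ (univ : Set E)) ⊆ Ici 0 ×ˢ univ :=
    prod_mono Ioi_subset_Ici_self Subset.rfl
  have cu := hj.cont_u
  have cut := hj.cont_ut
  have cux := hj.cont_ux
  have cu' := hj.cont_u.mono hsub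
  have cut' := hj.cont_ut.mono hsub
  have cux' := fun i => (hj.cont_ux i).mono hsub
  have cutt := hj.cont_utt
  have cuxt := hj.cont_uxt
  have cuxx := hj.cont_uxx
  have hkc : ContinuousOn (fun z : ℝ × E => k z.1 z.2) (Ici 0 ×ˢ univ) := by
    simp only [k, e]
    fun_prop
  have hk'c : ContinuousOn (fun z : ℝ × E => k' z.1 z.2) (Ioi 0 ×ˢ univ) := by
    simp only [k', e]
    fun_prop
  have hgc : ∀ i, ContinuousOn (fun z : ℝ × E => g i z.1 z.2) (Ioi 0 ×ˢ univ) := by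
    intro i
    simp only [g]
    fun_prop
  have hg'c : ∀ i, ContinuousOn (fun z : ℝ × E => g' i z.1 z.2) (Ioi 0 ×ˢ univ) := by
    intro i
    simp only [g']
    fun_prop
  have hmsupp : ∀ T, ∀ t ∈ Icc 0 T, ∀ x, x ∉ Metric.closedBall x₀ (t₀ + T) → m t x = 0 := by
    intro T t ht x hx
    refine max_eq_right (coneFun_nonpos_of_notMem x₀ ?_ hx)
    rw [abs_le]
    constructor <;> linarith [ht.1, ht.2]
  have hmsupp' : ∀ t ∈ Ioo 0 t₀, ∀ x, x ∉ Metric.closedBall x₀ t₀ → m t x = 0 := by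
    intro t ht x hx
    refine max_eq_right (coneFun_nonpos_of_notMem x₀ ?_ hx)
    rw [abs_le]
    constructor <;> linarith [ht.1, ht.2]
  let En : ℝ → ℝ := fun t => ∫ x, k t x
  have hEc : ContinuousOn En (Ici 0) :=
    continuousOn_integral_of_compact hkc (fun T => isCompact_closedBall x₀ (t₀ + T))
      fun T t ht x hx => by simp [k, hmsupp T t ht x hx]
  have hEd : ∀ t ∈ Ioo 0 t₀, HasDerivAt En (∫ x, k' t x) t := by
    intro t ht
    have hs : Ioo 0 t₀ ×ˢ (univ : Set E) ⊆ Ioi 0 ×ˢ univ := prod_mono (fun s hs => hs.1) Subset.rfl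
    refine hasDerivAt_integral_of_compact (isCompact_closedBall x₀ t₀) ht
      (hkc.mono (hs.trans hsub)) (hk'c.mono hs) (fun s hs x => ?_)
      (fun s hs x hx => by simp [k, hmsupp' s hs x hx])
    have d1 := (hj.deriv_ut s hs.1 x).pow 2
    have d2 := HasDerivAt.fun_sum (u := Finset.univ) fun i _ => (hj.deriv_ux i s hs.1 x).pow 2
    have d3 := (hj.deriv_u s hs.1 x).pow 2
    have d4 := ((((d1.add d2).add d3).div_const 2)).mul (hasDerivAt_coneFun t₀ x₀ s x)
    convert! d4 using 1
    simp only [k', e, m]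
    have : ∑ i, 2 * ux i s x * uxt i s x = 2 * ∑ i, ux i s x * uxt i s x := by
      simp only [Finset.mul_sum, mul_assoc]
    simp only [Pi.add_apply, Pi.pow_apply, Nat.cast_ofNat, Nat.reduceSub, pow_one]
    rw [this]
    ring
  -- the divergence of the energy flux `g` integrates to zero
  have hg0 : ∀ t ∈ Ioo 0 t₀, ∀ i, ∫ x, g' i t x = 0 := by
    intro t ht i
    refine integral_lineDeriv_eq_zero (k := g i t) (v := b i)
      (continuous_slice (hgc i) ht.1) (continuous_slice (hg'c i) ht.1)
      (isCompact_closedBall x₀ t₀) (fun x hx => by simp [g, hmsupp' t ht x hx]) fun x => ?_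
    have d1 : HasDerivAt (fun s : ℝ => ut t (x + s • b i)) _ 0 := hj.line_ut i t ht.1 x
    have d2 : HasDerivAt (fun s : ℝ => ux i t (x + s • b i)) _ 0 := hj.line_ux i t ht.1 x
    have d3 := hasLineDerivAt_coneFun t₀ x₀ t x (b i)
    unfold HasLineDerivAt at d3 ⊢
    have d4 := (d1.mul d2).mul d3
    convert! d4 using 1
    simp [g', m]
  have hpt : ∀ t ∈ Ioo 0 t₀, ∀ x, k' t x - ∑ i, g' i t x ≤ (M + 1) * k t x := by
    intro t ht x
    set S := ∑ i, ux i t x * inner ℝ (x - x₀) (b i) with hS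
    have hid : k' t x - ∑ i, g' i t x = ut t x * F t x * m t x ^ 2 + u t x * ut t x * m t x ^ 2
        - 4 * m t x * ((t₀ - t) * e t x - ut t x * S) := by
      have : ∑ i, g' i t x = (∑ i, ux i t x * uxt i t x) * m t x ^ 2
          + ut t x * (∑ i, uxx i t x) * m t x ^ 2 - 4 * m t x * ut t x * S := by
        simp only [g', hS, Finset.mul_sum, Finset.sum_mul, ← Finset.sum_add_distrib,
          ← Finset.sum_sub_distrib]
        refine Finset.sum_congr rfl fun i _ => ?_
        ring
      rw [this]
      simp only [k']
      rw [eqn t ht.1 x]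
      ring
    rw [hid]
    have hgrad : 0 ≤ ∑ i, ux i t x ^ 2 := by positivity
    have e1 : |ut t x| * |u t x| ≤ e t x := by
      simp only [e]
      nlinarith [sq_nonneg (|ut t x| - |u t x|), sq_abs (ut t x), sq_abs (u t x)]
    by_cases hm : m t x = 0
    · simp [hm, k]
    have hball : x ∈ Metric.closedBall x₀ t₀ := by
      by_contra hx
      exact hm (hmsupp' t ht x hx)
    have hlt : ‖x - x₀‖ ^ 2 ≤ (t₀ - t) ^ 2 := by
      by_contra hlt
      exact hm (max_eq_right (by unfold coneFun; linarith))
    have ha : 0 < t₀ - t := by linarith [ht.2]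
    have hS2 : S ^ 2 ≤ (∑ i, ux i t x ^ 2) * (t₀ - t) ^ 2 := by
      refine (Finset.sum_mul_sq_le_sq_mul_sq _ _ _).trans ?_
      have : ∑ i, inner ℝ (x - x₀) (b i) ^ 2 = ‖x - x₀‖ ^ 2 := by
        have := b.sum_sq_norm_inner_left (x - x₀)
        simpa using this
      rw [this]
      gcongr
    have hcone : ut t x * S ≤ (t₀ - t) * e t x := by
      have h3 : 2 * (t₀ - t) * (ut t x * S) ≤ (t₀ - t) ^ 2 * ut t x ^ 2 + S ^ 2 := by
        nlinarith [sq_nonneg ((t₀ - t) * ut t x - S)]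
      have h4 : 2 * (t₀ - t) * (ut t x * S) ≤ 2 * (t₀ - t) * ((t₀ - t) * e t x) := by
        simp only [e]
        nlinarith [mul_nonneg (sq_nonneg (t₀ - t)) (sq_nonneg (u t x))]
      exact le_of_mul_le_mul_left h4 (by linarith)
    have h5 : ut t x * F t x ≤ M * e t x := by
      calc ut t x * F t x ≤ |ut t x| * |F t x| := by rw [← abs_mul]; exact le_abs_self _
        _ ≤ |ut t x| * (M * |u t x|) := by gcongr; exact hM t ht x hball
        _ = M * (|ut t x| * |u t x|) := by ring
        _ ≤ _ := by gcongr
    have h6 : u t x * ut t x ≤ e t x := by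
      refine le_trans ?_ e1
      rw [mul_comm, ← abs_mul]
      exact le_abs_self _
    have h7 := mul_le_mul_of_nonneg_right (add_le_add h5 h6) (sq_nonneg (m t x))
    have h8 : 0 ≤ 4 * m t x * ((t₀ - t) * e t x - ut t x * S) :=
      mul_nonneg (mul_nonneg (by norm_num) (hm0 t x)) (by linarith)
    simp only [k]
    nlinarith
  have hEle : ∀ t ∈ Ioo 0 t₀, ∫ x, k' t x ≤ (M + 1) * En t := by
    intro t ht
    have ht' : t ∈ Ioi (0 : ℝ) := ht.1
    have hK := isCompact_closedBall x₀ t₀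
    have i1 : Integrable (k' t) := integrable_of_continuous_of_compact
      (continuous_slice hk'c ht') hK fun x hx => by simp [k', hmsupp' t ht x hx]
    have i2 : ∀ i ∈ Finset.univ, Integrable (g' i t) := fun i _ =>
      integrable_of_continuous_of_compact (continuous_slice (hg'c i) ht') hK
        fun x hx => by simp [g', hmsupp' t ht x hx]
    have i3 : Integrable (k t) := integrable_of_continuous_of_compact
      (continuous_slice hkc ht.1.le) hK fun x hx => by simp [k, hmsupp' t ht x hx]
    have : ∫ x, k' t x = ∫ x, (k' t x - ∑ i, g' i t x) := by
      rw [integral_sub i1 (integrable_finsetSum _ i2), integral_finsetSum _ i2]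
      simp [hg0 t ht]
    rw [this]
    simp only [En]
    rw [← integral_const_mul]
    exact integral_mono (i1.sub (integrable_finsetSum _ i2)) (i3.const_mul _) (hpt t ht)
  have hE0 : En 0 = 0 := by
    simp only [En]
    rw [integral_eq_zero_of_ae (Eventually.of_forall fun x => ?_)]
    simp only [Pi.zero_apply]
    by_cases hx : R₀ < ‖x‖
    · have hux : ∀ i, ux i 0 x = 0 := by
        intro i
        have hz : HasLineDerivAt ℝ (fun _ : E => (0 : ℝ)) 0 x (b i) :=
          hasDerivAt_const (0 : ℝ) (0 : ℝ)
        refine (hj.line_u i 0 le_rfl x).unique (hz.congr_of_eventuallyEq ?_)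
        filter_upwards [(isOpen_lt continuous_const continuous_norm).mem_nhds hx] with y hy
          using h0 y hy
      simp [k, e, h0 x hx, h1 x hx, hux]
    · have hm : m 0 x = 0 := by
        refine max_eq_right ?_
        unfold coneFun
        have h2 : t₀ ≤ ‖x - x₀‖ := by
          have := norm_sub_norm_le x₀ x
          rw [norm_sub_rev] at this
          linarith
        have : t₀ ^ 2 ≤ ‖x - x₀‖ ^ 2 := by gcongr
        simpa using this
      simp [k, hm]
  -- Gronwall's inequality: `En t * exp (-(M + 1) t)` is nonincreasing and vanishes at `t = 0`
  have hEτ : En τ ≤ 0 := by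
    have hanti : AntitoneOn (fun t => En t * Real.exp (-(M + 1) * t)) (Icc 0 τ) := by
      have hd : ∀ t ∈ Ioo 0 τ, HasDerivAt (fun t => En t * Real.exp (-(M + 1) * t))
          ((∫ x, k' t x) * Real.exp (-(M + 1) * t)
            + En t * (Real.exp (-(M + 1) * t) * (-(M + 1)))) t := fun t ht => by
        have := ((hasDerivAt_id t).const_mul (-(M + 1))).exp
        simp only [id, mul_one] at this
        exact (hEd t ⟨ht.1, ht.2.trans hτt⟩).mul this
      refine antitoneOn_of_deriv_nonpos (convex_Icc 0 τ)
        ((hEc.mono Icc_subset_Ici_self).mul (by fun_prop)) (fun t ht => ?_) (fun t ht => ?_)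
      · rw [interior_Icc] at ht
        exact (hd t ht).differentiableAt.differentiableWithinAt
      · rw [interior_Icc] at ht
        rw [(hd t ht).deriv]
        have h2 := hEle t ⟨ht.1, ht.2.trans hτt⟩
        have h3 := Real.exp_pos (-(M + 1) * t)
        nlinarith
    have h2 := hanti ⟨le_rfl, hτ⟩ ⟨hτ, le_rfl⟩ hτ
    simp only [hE0, zero_mul] at h2
    exact nonpos_of_mul_nonpos_left h2 (Real.exp_pos _)
  by_contra hne
  have hkpos : k τ x₀ ≠ 0 := by
    have h2 : 0 < e τ x₀ := by
      have h3 : 0 < u τ x₀ ^ 2 := by positivity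
      have h4 : 0 ≤ ∑ i, ux i τ x₀ ^ 2 := by positivity
      have h5 := sq_nonneg (ut τ x₀)
      simp only [e]
      linarith
    have h3 : 0 < m τ x₀ := by
      refine lt_max_of_lt_left ?_
      unfold coneFun
      rw [sub_self, norm_zero]
      have : 0 < t₀ - τ := by linarith
      simp
      positivity
    positivity
  have hpos := (continuous_slice hkc hτ).integral_pos_of_hasCompactSupport_nonneg_nonzero
    (μ := (volume : Measure E)) (HasCompactSupport.intro (isCompact_closedBall x₀ (t₀ + τ))
      fun x hx => by simp [k, hmsupp τ τ ⟨hτ, le_rfl⟩ x hx]) (hk0 τ) hkpos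
  exact absurd hpos (not_lt.2 hEτ)

end FiniteSpeed

open Metric Pointwise

/-! ### Averages of plane waves over the unit sphere -/

section Sphere

variable {E : Type*} [NormedAddCommGroup E] [InnerProductSpace ℝ E]
  [FiniteDimensional ℝ E] [MeasurableSpace E] [BorelSpace E]

/-- A spherical cap of height `s` has measure at most of order `s ^ ((d - 1) / 2)`: the cone over
it is contained in a box with one side of length `2` and the others of length `2 √(2 s)`. -/
theorem exists_toSphere_cap_le [Nontrivial E] :
    ∃ C : ℝ, 0 ≤ C ∧ ∀ e : E, ‖e‖ = 1 → ∀ s : ℝ, 0 < s →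
      (volume : Measure E).toSphere.real {ω : sphere (0 : E) 1 | 1 - s ≤ inner ℝ e (ω : E)}
        ≤ C * s ^ (((Module.finrank ℝ E : ℝ) - 1) / 2) := by
  set d := Module.finrank ℝ E with hd
  have hd0 : 0 < d := Module.finrank_pos
  refine ⟨d * (2 * (2 * √2) ^ (d - 1)), by positivity, fun e he s hs => ?_⟩
  -- in an orthonormal basis containing `e`, the coordinates of the cone over the cap orthogonal to
  -- `e` are at most `√(2 s)`
  let i₀ : Fin d := ⟨0, hd0⟩
  obtain ⟨b, hb⟩ := Orthonormal.exists_orthonormalBasis_extension_of_card_eq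
    (𝕜 := ℝ) (E := E) (ι := Fin d) (by simp [hd]) (v := fun _ => e) (s := {i₀})
    (by
      constructor
      · intro i; simpa using he
      · intro i j hij; exact absurd (Subsingleton.elim i j) hij)
  have hb0 : b i₀ = e := hb i₀ rfl
  set c := √(2 * s) with hc
  let B : Fin d → Set ℝ := fun i => if i = i₀ then Icc (-1) 1 else Icc (-c) c
  have hBm : MeasurableSet (univ.pi B) := by
    refine MeasurableSet.univ_pi fun i => ?_
    simp only [B]
    split_ifs <;> exact measurableSet_Icc
  have hBv : volume (univ.pi B) = ENNReal.ofReal (2 * (2 * c) ^ (d - 1)) := by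
    rw [volume_pi_pi]
    have : ∀ i, volume (B i) = ENNReal.ofReal (if i = i₀ then 2 else 2 * c) := by
      intro i
      simp only [B]
      split_ifs
      · rw [Real.volume_Icc]; norm_num
      · rw [Real.volume_Icc]; ring_nf
    simp only [this]
    rw [← ENNReal.ofReal_prod_of_nonneg (fun i _ => by split_ifs <;> positivity)]
    rw [← Finset.mul_prod_erase Finset.univ _ (Finset.mem_univ i₀)]
    rw [if_pos rfl, Finset.prod_congr rfl (g := fun _ => 2 * c)
      (fun i hi => if_neg (Finset.ne_of_mem_erase hi))]
    simp
  have hmeas : MeasurableSet {ω : sphere (0 : E) 1 | 1 - s ≤ inner ℝ e (ω : E)} := by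
    refine (isClosed_le continuous_const ?_).measurableSet
    fun_prop
  have hpre : volume ((fun y : E => (WithLp.ofLp (b.repr y) : Fin d → ℝ)) ⁻¹' (univ.pi B))
      = volume (univ.pi B) :=
    ((PiLp.volume_preserving_ofLp (Fin d)).comp
      b.measurePreserving_repr).measure_preimage hBm.nullMeasurableSet
  have hsub : Ioo (0 : ℝ) 1 • ((↑) '' {ω : sphere (0 : E) 1 | 1 - s ≤ inner ℝ e (ω : E)} : Set E)
      ⊆ (fun y : E => (WithLp.ofLp (b.repr y) : Fin d → ℝ)) ⁻¹' (univ.pi B) := by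
    rintro _ ⟨r, hr, _, ⟨ω, hω, rfl⟩, rfl⟩
    have hω1 : ‖(ω : E)‖ = 1 := by simp
    simp only [mem_ofPred_eq] at hω
    have hle1 : inner ℝ e (ω : E) ≤ 1 := by
      have := real_inner_le_norm e (ω : E)
      rwa [he, hω1, one_mul] at this
    have hge1 : -1 ≤ inner ℝ e (ω : E) := by
      have := neg_le_of_abs_le (abs_real_inner_le_norm e (ω : E))
      rwa [he, hω1, one_mul] at this
    intro i _
    simp only [map_smul, PiLp.smul_apply, smul_eq_mul, OrthonormalBasis.repr_apply_apply, B]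
    split_ifs with hi
    · rw [hi, hb0]
      constructor <;> nlinarith [hr.1, hr.2]
    · have hsum : ∑ j, inner ℝ (b j) (ω : E) ^ 2 = 1 := by
        have := b.sum_sq_norm_inner_right (ω : E)
        rw [hω1] at this
        simpa using this
      have h2 : inner ℝ e (ω : E) ^ 2 + inner ℝ (b i) (ω : E) ^ 2 ≤ 1 := by
        refine le_of_le_of_eq ?_ hsum
        rw [← hb0, ← Finset.sum_pair (f := fun j => inner ℝ (b j) (ω : E) ^ 2) (Ne.symm hi)]
        exact Finset.sum_le_sum_of_subset_of_nonneg (Finset.subset_univ _)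
          fun j _ _ => sq_nonneg _
      have h3 : inner ℝ (b i) (ω : E) ^ 2 ≤ 2 * s := by nlinarith
      have h4 : |inner ℝ (b i) (ω : E)| ≤ c := Real.abs_le_sqrt h3
      refine abs_le.1 ?_
      rw [abs_mul, abs_of_pos hr.1]
      have := abs_nonneg (inner ℝ (b i) (ω : E))
      nlinarith [hr.1, hr.2]
  have hle : (volume : Measure E).toSphere {ω : sphere (0 : E) 1 | 1 - s ≤ inner ℝ e (ω : E)}
      ≤ ENNReal.ofReal (d * (2 * (2 * c) ^ (d - 1))) := by
    rw [Measure.toSphere_apply' _ hmeas, ENNReal.ofReal_mul (by positivity), ENNReal.ofReal_natCast]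
    gcongr
    exact (measure_mono hsub).trans (hpre.trans hBv).le
  refine (ENNReal.toReal_le_of_le_ofReal (by positivity) hle).trans (le_of_eq ?_)
  have h5 : √s ^ (d - 1) = s ^ (((d : ℝ) - 1) / 2) := by
    rw [Real.sqrt_eq_rpow, ← Real.rpow_natCast, ← Real.rpow_mul hs.le, Nat.cast_sub hd0,
      Nat.cast_one]
    ring_nf
  rw [hc, Real.sqrt_mul (by norm_num), ← mul_assoc 2, mul_pow, h5]
  ring

/-- The sublevel sets of the phase `ω ↦ τ - ⟪x, ω⟫`, uniformly for `‖x‖ ≤ τ`. -/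
theorem exists_toSphere_phase_le [Nontrivial E] :
    ∃ C : ℝ, 0 ≤ C ∧ ∀ τ : ℝ, 0 < τ → ∀ x : E, ‖x‖ ≤ τ → ∀ s : ℝ, 0 < s →
      (volume : Measure E).toSphere.real {ω : sphere (0 : E) 1 | τ - inner ℝ x (ω : E) ≤ s}
        ≤ C * (s / τ) ^ (((Module.finrank ℝ E : ℝ) - 1) / 2) := by
  set κ := ((Module.finrank ℝ E : ℝ) - 1) / 2 with hκ
  have hκ0 : 0 ≤ κ := by
    have : (1 : ℝ) ≤ Module.finrank ℝ E := by exact_mod_cast Module.finrank_pos (R := ℝ) (M := E)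
    rw [hκ]; linarith
  obtain ⟨C, hC0, hC⟩ := exists_toSphere_cap_le (E := E)
  set σ := (volume : Measure E).toSphere
  refine ⟨max C (σ.real univ) * 2 ^ κ, by positivity, fun τ hτ x hx s hs => ?_⟩
  have key : max C (σ.real univ) * 2 ^ κ * (s / τ) ^ κ
      = max C (σ.real univ) * (2 * (s / τ)) ^ κ := by
    rw [Real.mul_rpow (by norm_num) (by positivity)]; ring
  rw [key]
  have hin : ∀ ω : sphere (0 : E) 1, inner ℝ x (ω : E) ≤ ‖x‖ := fun ω => by
    have h1 : ‖(ω : E)‖ = 1 := by simp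
    simpa [h1] using real_inner_le_norm x (ω : E)
  -- for `‖x‖ ≤ τ / 2` the phase is at least `τ / 2`; otherwise the sublevel set is in a cap of
  -- height `s / ‖x‖ ≤ 2 s / τ`
  rcases le_or_gt ‖x‖ (τ / 2) with h | h
  · rcases lt_or_ge s (τ / 2) with h2 | h2
    · have : {ω : sphere (0 : E) 1 | τ - inner ℝ x (ω : E) ≤ s} = ∅ := by
        refine eq_empty_of_forall_notMem fun ω hω => ?_
        have := hin ω
        simp only [mem_ofPred_eq] at hω
        linarith
      rw [this, measureReal_empty]
      positivity
    · have h3 : (1 : ℝ) ≤ (2 * (s / τ)) ^ κ := by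
        refine Real.one_le_rpow ?_ hκ0
        rw [← mul_div_assoc, le_div_iff₀ hτ]
        linarith
      calc _ ≤ σ.real univ := measureReal_mono (subset_univ _)
        _ ≤ max C (σ.real univ) * 1 := by rw [mul_one]; exact le_max_right _ _
        _ ≤ _ := by gcongr
  · have hx0 : 0 < ‖x‖ := by linarith
    have he : ‖(‖x‖⁻¹ • x)‖ = 1 := by
      rw [norm_smul, norm_inv, norm_norm, inv_mul_cancel₀ hx0.ne']
    have hsub : {ω : sphere (0 : E) 1 | τ - inner ℝ x (ω : E) ≤ s}
        ⊆ {ω : sphere (0 : E) 1 | 1 - s / ‖x‖ ≤ inner ℝ (‖x‖⁻¹ • x) (ω : E)} := by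
      intro ω hω
      simp only [mem_ofPred_eq] at hω ⊢
      rw [real_inner_smul_left, inv_mul_eq_div, sub_le_iff_le_add, ← add_div, le_div_iff₀ hx0]
      linarith
    calc _ ≤ _ := measureReal_mono hsub
      _ ≤ C * (s / ‖x‖) ^ κ := hC _ he _ (by positivity)
      _ ≤ max C (σ.real univ) * (2 * (s / τ)) ^ κ := by
          gcongr
          · exact le_max_left _ _
          · rw [← mul_div_assoc, div_le_div_iff₀ hx0 hτ]
            nlinarith

/-- Decay of averaged plane waves: away from the light cone `‖x‖ = τ` the average of
`(τ - ⟪x, ω⟫) ^ (-(κ + δ))` decays like `τ ^ (-κ)`, where `κ = (d - 1) / 2`. -/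
theorem exists_integral_sphere_rpow_le [Nontrivial E] {δ : ℝ} (hδ : 0 < δ) :
    ∃ C : ℝ, 0 ≤ C ∧ ∀ τ : ℝ, 0 < τ → ∀ x : E, ‖x‖ < τ →
      ∫ ω : sphere (0 : E) 1, (τ - inner ℝ x (ω : E)) ^
          (-(((Module.finrank ℝ E : ℝ) - 1) / 2 + δ)) ∂(volume : Measure E).toSphere
        ≤ C * τ ^ (-(((Module.finrank ℝ E : ℝ) - 1) / 2)) * (τ - ‖x‖) ^ (-δ) := by
  set κ := ((Module.finrank ℝ E : ℝ) - 1) / 2 with hκ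
  have hκ0 : 0 ≤ κ := by
    have : (1 : ℝ) ≤ Module.finrank ℝ E := by exact_mod_cast Module.finrank_pos (R := ℝ) (M := E)
    rw [hκ]; linarith
  obtain ⟨C, hC0, hC⟩ := exists_toSphere_phase_le (E := E)
  set σ := (volume : Measure E).toSphere
  refine ⟨(κ + δ) * (C / δ), by positivity, fun τ hτ x hx => ?_⟩
  set a := τ - ‖x‖ with ha
  have ha0 : 0 < a := by linarith
  have hq : ∀ ω : sphere (0 : E) 1, a ≤ τ - inner ℝ x (ω : E) := fun ω => by
    have h1 : ‖(ω : E)‖ = 1 := by simp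
    have := real_inner_le_norm x (ω : E)
    rw [h1, mul_one] at this
    linarith
  have hqc : Continuous fun ω : sphere (0 : E) 1 => τ - inner ℝ x (ω : E) := by fun_prop
  let f : sphere (0 : E) 1 → ℝ := fun ω => (τ - inner ℝ x (ω : E))⁻¹
  have hf0 : ∀ ω, 0 < f ω := fun ω => inv_pos.2 (ha0.trans_le (hq ω))
  have hfc : Continuous f := hqc.inv₀ fun ω => (ha0.trans_le (hq ω)).ne'
  have hfp : ∀ ω : sphere (0 : E) 1, (τ - inner ℝ x (ω : E)) ^ (-(κ + δ)) = f ω ^ (κ + δ) := by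
    intro ω
    rw [Real.rpow_neg (ha0.trans_le (hq ω)).le, Real.inv_rpow (ha0.trans_le (hq ω)).le]
  -- layer-cake formula, with the sublevel sets of the phase bounded by `hC`; they are empty below
  -- the minimal phase `a`
  have hlayer := lintegral_rpow_eq_lintegral_meas_le_mul σ
    (Eventually.of_forall fun ω => (hf0 ω).le) hfc.measurable.aemeasurable
    (show 0 < κ + δ by linarith)
  let G : ℝ → ℝ := fun t => C * τ ^ (-κ) * t ^ (δ - 1)
  have hGi : IntegrableOn G (Ioc 0 a⁻¹) := by
    have : IntervalIntegrable (fun t : ℝ => t ^ (δ - 1)) volume 0 a⁻¹ :=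
      intervalIntegral.intervalIntegrable_rpow' (by linarith)
    exact (((intervalIntegrable_iff_integrableOn_Ioc_of_le (by positivity)).1 this).const_mul _)
  have hGint : ∫ t in Ioc 0 a⁻¹, G t = C * τ ^ (-κ) * (a ^ (-δ) / δ) := by
    rw [← intervalIntegral.integral_of_le (by positivity), intervalIntegral.integral_const_mul,
      integral_rpow (Or.inl (by linarith))]
    rw [sub_add_cancel, Real.zero_rpow hδ.ne', sub_zero, Real.inv_rpow ha0.le,
      Real.rpow_neg ha0.le]
  have hbound : ∫⁻ t in Ioi (0 : ℝ), σ {ω | t ≤ f ω} * ENNReal.ofReal (t ^ (κ + δ - 1))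
      ≤ ENNReal.ofReal (C * τ ^ (-κ) * (a ^ (-δ) / δ)) := by
    rw [← hGint, ofReal_integral_eq_lintegral_ofReal hGi]
    · rw [← lintegral_indicator measurableSet_Ioi, ← lintegral_indicator measurableSet_Ioc]
      refine lintegral_mono fun t => ?_
      by_cases ht : 0 < t
      · rw [indicator_of_mem (show t ∈ Ioi (0 : ℝ) from ht)]
        by_cases hta : t ≤ a⁻¹
        · rw [indicator_of_mem (show t ∈ Ioc 0 a⁻¹ from ⟨ht, hta⟩)]
          have hset : {ω | t ≤ f ω}
              ⊆ {ω : sphere (0 : E) 1 | τ - inner ℝ x (ω : E) ≤ t⁻¹} := by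
            intro ω hω
            have h1 : t ≤ (τ - inner ℝ x (ω : E))⁻¹ := hω
            exact (le_inv_comm₀ ht (ha0.trans_le (hq ω))).1 h1
          have h2 : σ {ω | t ≤ f ω} ≤ ENNReal.ofReal (C * (t⁻¹ / τ) ^ κ) := by
            refine (measure_mono hset).trans ?_
            rw [← ofReal_measureReal]
            exact ENNReal.ofReal_le_ofReal (hC τ hτ x hx.le _ (by positivity))
          refine (mul_le_mul_left h2 _).trans (le_of_eq ?_)
          rw [← ENNReal.ofReal_mul (by positivity)]
          congr 1
          simp only [G]
          rw [Real.div_rpow (by positivity) hτ.le, Real.inv_rpow ht.le, Real.rpow_neg hτ.le,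
            show κ + δ - 1 = κ + (δ - 1) by ring, Real.rpow_add ht]
          have : t ^ κ ≠ 0 := (Real.rpow_pos_of_pos ht κ).ne'
          field_simp
        · have : {ω | t ≤ f ω} = ∅ := by
            refine eq_empty_of_forall_notMem fun ω hω => hta ?_
            exact le_trans (show t ≤ f ω from hω) (inv_anti₀ ha0 (hq ω))
          rw [this, measure_empty, zero_mul]
          exact zero_le
      · rw [indicator_of_notMem (show t ∉ Ioi (0 : ℝ) from ht)]
        exact zero_le
    · refine (ae_restrict_iff' measurableSet_Ioc).2 (Eventually.of_forall fun t ht => ?_)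
      have := ht.1
      simp only [G, Pi.zero_apply]
      positivity
  simp only [hfp]
  rw [integral_eq_lintegral_of_nonneg_ae
    (Eventually.of_forall fun ω => (Real.rpow_pos_of_pos (hf0 ω) _).le)
    (hfc.rpow_const fun ω => Or.inl (hf0 ω).ne').aestronglyMeasurable, hlayer]
  refine ENNReal.toReal_le_of_le_ofReal (by positivity) ((mul_le_mul_right hbound _).trans
    (le_of_eq ?_))
  rw [← ENNReal.ofReal_mul (by linarith)]
  congr 1
  ring

/-- In polar coordinates, `(τ - ‖x‖)⁻¹` integrates logarithmically over the ball of radius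
`τ - 1`. -/
theorem exists_integral_ball_inv_le [Nontrivial E] :
    ∃ C : ℝ, 0 ≤ C ∧ ∀ τ : ℝ, 1 ≤ τ →
      ∫ x in closedBall (0 : E) (τ - 1), (τ - ‖x‖)⁻¹
        ≤ C * τ ^ ((Module.finrank ℝ E : ℝ) - 1) * Real.log τ := by
  set d := Module.finrank ℝ E with hd
  have hd0 : 0 < d := Module.finrank_pos
  refine ⟨d * (volume : Measure E).real (ball 0 1), by positivity, fun τ hτ => ?_⟩
  let f : ℝ → ℝ := (Iic (τ - 1)).indicator fun r => (τ - r)⁻¹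
  have h1 : ∫ x in closedBall (0 : E) (τ - 1), (τ - ‖x‖)⁻¹ = ∫ x : E, f ‖x‖ := by
    rw [← integral_indicator measurableSet_closedBall]
    congr 1
    ext x
    by_cases hx : ‖x‖ ≤ τ - 1
    · rw [indicator_of_mem (by simpa using hx)]
      simp only [f]
      rw [indicator_of_mem (show ‖x‖ ∈ Iic (τ - 1) from hx)]
    · rw [indicator_of_notMem (by simpa using hx)]
      simp only [f]
      rw [indicator_of_notMem (show ‖x‖ ∉ Iic (τ - 1) from hx)]
  have h2 : ∫ r in Ioi (0 : ℝ), r ^ (d - 1) • f r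
      = ∫ r in (0 : ℝ)..(τ - 1), r ^ (d - 1) * (τ - r)⁻¹ := by
    rw [intervalIntegral.integral_of_le (by linarith), ← integral_indicator measurableSet_Ioi,
      ← integral_indicator measurableSet_Ioc]
    congr 1
    ext r
    simp only [f, indicator, mem_Ioi, mem_Iic, mem_Ioc, smul_eq_mul]
    split_ifs with h3 h4 h4 h4 <;> first | rfl | simp_all
  have hpos : ∀ r ∈ Icc (0 : ℝ) (τ - 1), 0 < τ - r := fun r hr => by linarith [hr.2]
  have hci : ContinuousOn (fun r : ℝ => (τ - r)⁻¹) (Icc 0 (τ - 1)) :=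
    ContinuousOn.inv₀ (by fun_prop) fun r hr => (hpos r hr).ne'
  have h3 : ∫ r in (0 : ℝ)..(τ - 1), r ^ (d - 1) * (τ - r)⁻¹
      ≤ ∫ r in (0 : ℝ)..(τ - 1), τ ^ (d - 1) * (τ - r)⁻¹ := by
    refine intervalIntegral.integral_mono_on (by linarith) ?_ ?_ fun r hr => ?_
    · exact ContinuousOn.intervalIntegrable_of_Icc (by linarith)
        ((continuousOn_id.pow _).mul hci)
    · exact ContinuousOn.intervalIntegrable_of_Icc (by linarith) (continuousOn_const.mul hci)
    · have := hpos r hr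
      have h4 := hr.1
      gcongr
      linarith
  have h4 : ∫ r in (0 : ℝ)..(τ - 1), (τ - r)⁻¹ = Real.log τ := by
    rw [intervalIntegral.integral_comp_sub_left (fun r => r⁻¹) τ, integral_inv]
    · simp
    · rw [uIcc_of_le (by linarith)]
      intro h
      linarith [h.1]
  have h5 : τ ^ (d - 1) = τ ^ ((d : ℝ) - 1) := by
    rw [← Real.rpow_natCast, Nat.cast_sub hd0, Nat.cast_one]
  rw [h1, integral_fun_norm_addHaar, h2]
  rw [intervalIntegral.integral_const_mul, h4, h5] at h3
  rw [nsmul_eq_mul, smul_eq_mul, ← hd]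
  calc _ ≤ (d : ℝ) * ((volume : Measure E).real (ball 0 1)
        * (τ ^ ((d : ℝ) - 1) * Real.log τ)) := by gcongr
    _ = _ := by ring

end Sphere

/-! ### Testing against averaged plane waves -/

section Averages

variable {ι E : Type*} [Fintype ι] [NormedAddCommGroup E]

/-- `w` vanishes outside the forward light cone `‖x‖ ≤ t + R`, for all times `t ∈ I`. -/
def SuppInCone (I : Set ℝ) (R : ℝ) (w : ℝ → E → ℝ) : Prop :=
  ∀ t ∈ I, ∀ x : E, t + R < ‖x‖ → w t x = 0

theorem SuppInCone.mono {I J : Set ℝ} {R : ℝ} {w : ℝ → E → ℝ} (h : SuppInCone J R w)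
    (hIJ : I ⊆ J) : SuppInCone I R w :=
  fun t ht => h t (hIJ ht)

theorem SuppInCone.deriv {R : ℝ} {w wt : ℝ → E → ℝ} (h : SuppInCone (Ioi 0) R w)
    (hd : ∀ t, 0 < t → ∀ x, HasDerivAt (fun s => w s x) (wt t x) t) :
    SuppInCone (Ioi 0) R wt := by
  intro t ht x hx
  refine (hd t ht x).unique ((hasDerivAt_const t (0 : ℝ)).congr_of_eventuallyEq ?_)
  have h1 : ∀ᶠ s in 𝓝 t, s < ‖x‖ - R := Iio_mem_nhds (by linarith)
  filter_upwards [h1, Ioi_mem_nhds ht] with s hs hs0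
  exact h s hs0 x (by linarith)

theorem lt_norm_of_notMem {r : ℝ} {z : sphere (0 : E) 1 × E}
    (hz : z ∉ (univ : Set (sphere (0 : E) 1)) ×ˢ closedBall (0 : E) r) : r < ‖z.2‖ := by
  by_contra h
  exact hz ⟨mem_univ _, by simpa using h⟩

variable [InnerProductSpace ℝ E]

theorem SuppInCone.lineDeriv {R : ℝ} {w wx : ℝ → E → ℝ} {y : E}
    (h : SuppInCone (Ioi 0) R w)
    (hd : ∀ t, 0 < t → ∀ x, HasLineDerivAt ℝ (w t) (wx t x) x y) :
    SuppInCone (Ioi 0) R wx := by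
  intro t ht x hx
  have h0 : HasLineDerivAt ℝ (fun _ : E => (0 : ℝ)) 0 x y := hasDerivAt_const (0 : ℝ) (0 : ℝ)
  refine (hd t ht x).unique (h0.congr_of_eventuallyEq ?_)
  filter_upwards [(isOpen_lt continuous_const continuous_norm).mem_nhds hx] with z hz
  exact h t ht z hz

/-- The phase `t + ρ - ⟪x, ω⟫` of a plane wave in the direction `ω`, at `z = (ω, x)`. -/
def phase (ρ t : ℝ) (z : sphere (0 : E) 1 × E) : ℝ := t + ρ - inner ℝ z.2 (z.1 : E)

theorem continuous_phase (ρ : ℝ) :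
    Continuous fun y : ℝ × (sphere (0 : E) 1 × E) => phase ρ y.1 y.2 := by
  unfold phase; fun_prop

theorem abs_inner_sphere_le (x : E) (ω : sphere (0 : E) 1) : |inner ℝ x (ω : E)| ≤ ‖x‖ := by
  have h1 : ‖(ω : E)‖ = 1 := by simp
  simpa [h1] using abs_real_inner_le_norm x (ω : E)

variable {ρ R : ℝ} {f f' f'' : ℝ → ℝ}

theorem continuousOn_mul_phase {s : Set ℝ} {w : ℝ → E → ℝ}
    (hw : ContinuousOn (fun y : ℝ × E => w y.1 y.2) (s ×ˢ univ)) (hf : Continuous f) :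
    ContinuousOn (fun y : ℝ × (sphere (0 : E) 1 × E) => w y.1 y.2.2 * f (phase ρ y.1 y.2))
      (s ×ˢ univ) := by
  refine ContinuousOn.mul ?_ (hf.comp (continuous_phase ρ)).continuousOn
  exact hw.comp (f := fun y : ℝ × (sphere (0 : E) 1 × E) => (y.1, y.2.2)) (by fun_prop)
    fun y hy => ⟨hy.1, mem_univ _⟩

variable [FiniteDimensional ℝ E]

/-- The compact set of pairs `(ω, x)` with `‖x‖ ≤ r`. -/
theorem isCompact_sphere_prod (r : ℝ) :
    IsCompact ((univ : Set (sphere (0 : E) 1)) ×ˢ closedBall (0 : E) r) :=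
  isCompact_univ.prod (isCompact_closedBall 0 r)

variable [MeasurableSpace E] [BorelSpace E]

/-- The integral of `w t x * f (t + ρ - ⟪x, ω⟫)` over the directions `ω` in the unit sphere and
over `x`: the pairing of `w t` with a superposition of plane waves of profile `f`. -/
noncomputable def planeAvg (ρ : ℝ) (f : ℝ → ℝ) (w : ℝ → E → ℝ) (t : ℝ) : ℝ :=
  ∫ z : sphere (0 : E) 1 × E, w t z.2 * f (phase ρ t z) ∂((volume : Measure E).toSphere.prod volume)

theorem integrable_planeAvg {I : Set ℝ} {w : ℝ → E → ℝ}
    (hw : ContinuousOn (fun y : ℝ × E => w y.1 y.2) (I ×ˢ univ)) (hf : Continuous f)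
    (hs : SuppInCone I R w) {t : ℝ} (ht : t ∈ I) :
    Integrable (fun z : sphere (0 : E) 1 × E => w t z.2 * f (phase ρ t z))
      ((volume : Measure E).toSphere.prod volume) :=
  integrable_of_continuous_of_compact
    (continuous_slice (k := fun t (z : sphere (0 : E) 1 × E) => w t z.2 * f (phase ρ t z))
      (continuousOn_mul_phase hw hf) ht) (isCompact_sphere_prod (t + R))
    fun z hz => by rw [hs t ht z.2 (lt_norm_of_notMem hz), zero_mul]

theorem continuousOn_planeAvg {w : ℝ → E → ℝ}
    (hw : ContinuousOn (fun y : ℝ × E => w y.1 y.2) (Ici 0 ×ˢ univ)) (hf : Continuous f)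
    (hs : SuppInCone (Ici 0) R w) : ContinuousOn (planeAvg ρ f w) (Ici 0) := by
  refine continuousOn_integral_of_compact
    (k := fun t (z : sphere (0 : E) 1 × E) => w t z.2 * f (phase ρ t z))
    (continuousOn_mul_phase hw hf) (fun T => isCompact_sphere_prod (T + R)) ?_
  intro T t ht z hz
  have := lt_norm_of_notMem hz
  rw [hs t ht.1 z.2 (by linarith [ht.2]), zero_mul]

theorem hasDerivAt_planeAvg {w wt : ℝ → E → ℝ}
    (hw : ContinuousOn (fun y : ℝ × E => w y.1 y.2) (Ioi 0 ×ˢ univ))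
    (hwt : ContinuousOn (fun y : ℝ × E => wt y.1 y.2) (Ioi 0 ×ˢ univ))
    (hd : ∀ t, 0 < t → ∀ x, HasDerivAt (fun s => w s x) (wt t x) t)
    (hf : ∀ s, HasDerivAt f (f' s) s) (hf' : Continuous f')
    (hs : SuppInCone (Ioi 0) R w) {t : ℝ} (ht : 0 < t) :
    HasDerivAt (planeAvg ρ f w) (planeAvg ρ f wt t + planeAvg ρ f' w t) t := by
  have hfc : Continuous f := continuous_iff_continuousAt.2 fun s => (hf s).continuousAt
  have hsub : Ioo 0 (t + 1) ×ˢ (univ : Set (sphere (0 : E) 1 × E)) ⊆ Ioi 0 ×ˢ univ :=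
    prod_mono (fun s h => h.1) Subset.rfl
  have h := hasDerivAt_integral_of_compact (μ := (volume : Measure E).toSphere.prod volume)
    (k := fun t (z : sphere (0 : E) 1 × E) => w t z.2 * f (phase ρ t z))
    (k' := fun t z => wt t z.2 * f (phase ρ t z) + w t z.2 * f' (phase ρ t z))
    (isCompact_sphere_prod (t + 1 + R)) (a := 0) (b := t + 1) (t := t) ⟨ht, by linarith⟩
    ((continuousOn_mul_phase hw hfc).mono hsub)
    (((continuousOn_mul_phase hwt hfc).add (continuousOn_mul_phase hw hf')).mono hsub)
    (fun s h z => ?_) (fun s h z hz => ?_)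
  · rw [integral_add (integrable_planeAvg hwt hfc (hs.deriv hd) ht)
      (integrable_planeAvg hw hf' hs ht)] at h
    exact h
  · have hp : HasDerivAt (fun s => phase ρ s z) 1 s := by
      simpa [phase] using ((hasDerivAt_id s).add_const ρ).sub_const (inner ℝ z.2 (z.1 : E))
    have h2 := (hd s h.1 z.2).mul ((hf _).comp s hp)
    exact h2.congr_deriv (by simp)
  · have := lt_norm_of_notMem hz
    rw [hs s h.1 z.2 (by linarith [h.2]), zero_mul]

/-- Green's identity in space: plane waves of profile `f` have Laplacian of profile `f''`. -/
theorem IsJet.integral_laplacian_sub_eq_zero {b : OrthonormalBasis ι ℝ E}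
    {u ut utt : ℝ → E → ℝ} {ux uxt uxx : ι → ℝ → E → ℝ} (hj : IsJet b u ut utt ux uxt uxx)
    (hf : ∀ s, HasDerivAt f (f' s) s) (hf' : ∀ s, HasDerivAt f' (f'' s) s)
    (hf'' : Continuous f'') (hs : SuppInCone (Ici 0) R u) {t : ℝ} (ht : 0 < t) (i : ι) :
    ∫ z : sphere (0 : E) 1 × E, (uxx i t z.2 * f (phase ρ t z)
      - u t z.2 * f'' (phase ρ t z) * inner ℝ (b i) (z.1 : E) ^ 2)
        ∂((volume : Measure E).toSphere.prod volume) = 0 := by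
  have hfc : Continuous f := continuous_iff_continuousAt.2 fun s => (hf s).continuousAt
  have hfc' : Continuous f' := continuous_iff_continuousAt.2 fun s => (hf' s).continuousAt
  have hsu : SuppInCone (Ioi 0) R u := hs.mono Ioi_subset_Ici_self
  have hsx : SuppInCone (Ioi 0) R (ux i) := hsu.lineDeriv fun t ht x => hj.line_u i t ht.le x
  have hsxx : SuppInCone (Ioi 0) R (uxx i) := hsx.lineDeriv (hj.line_ux i)
  have ht' : t ∈ Ioi (0 : ℝ) := ht
  have cu : Continuous (u t) := continuous_slice hj.cont_u ht.le
  have cux : Continuous (ux i t) := continuous_slice (hj.cont_ux i) ht.le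
  have cuxx : Continuous (uxx i t) := continuous_slice (hj.cont_uxx i) ht'
  have cph : Continuous fun z : sphere (0 : E) 1 × E => phase ρ t z := by
    unfold phase; fun_prop
  rw [integral_prod]
  · refine integral_eq_zero_of_ae (Eventually.of_forall fun ω => ?_)
    have cph' : Continuous fun x : E => phase ρ t (ω, x) := by unfold phase; fun_prop
    refine integral_lineDeriv_eq_zero (v := b i) (K := closedBall 0 (t + R))
      (k := fun x => ux i t x * f (phase ρ t (ω, x))
        + u t x * f' (phase ρ t (ω, x)) * inner ℝ (b i) (ω : E)) (by fun_prop) (by fun_prop)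
      (isCompact_closedBall _ _) (fun x hx => ?_) (fun x => ?_)
    · have hx' : t + R < ‖x‖ := by simpa using hx
      simp [hsx t ht x hx', hsu t ht x hx']
    · have d1 : HasDerivAt (fun s : ℝ => u t (x + s • b i)) _ 0 := hj.line_u i t ht.le x
      have d2 : HasDerivAt (fun s : ℝ => ux i t (x + s • b i)) _ 0 := hj.line_ux i t ht x
      have d3 : HasDerivAt (fun s : ℝ => phase ρ t (ω, x + s • b i))
          (-inner ℝ (b i) (ω : E)) 0 := by
        have h1 := ((hasDerivAt_id (0 : ℝ)).mul_const (inner ℝ (b i) (ω : E))).const_sub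
          (t + ρ - inner ℝ x (ω : E))
        simp only [one_mul] at h1
        refine h1.congr_of_eventuallyEq (Eventually.of_forall fun s => ?_)
        simp only [phase, inner_add_left, real_inner_smul_left, id]
        ring
      have d4 := (d2.mul ((hf _).comp (0 : ℝ) d3)).add
        ((d1.mul ((hf' _).comp (0 : ℝ) d3)).mul_const (inner ℝ (b i) (ω : E)))
      unfold HasLineDerivAt
      convert! d4 using 1
      simp
      ring
  · refine integrable_of_continuous_of_compact (by fun_prop) (isCompact_sphere_prod (t + R))
      fun z hz => ?_
    have := lt_norm_of_notMem hz
    simp [hsxx t ht z.2 this, hsu t ht z.2 this]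

/-- The averaged plane waves solve the wave equation, so that only the source term contributes to
the time derivative of the dual functional. -/
theorem IsJet.hasDerivAt_dual {b : OrthonormalBasis ι ℝ E} {u ut utt F : ℝ → E → ℝ}
    {ux uxt uxx : ι → ℝ → E → ℝ} (hj : IsJet b u ut utt ux uxt uxx)
    (eqn : ∀ t, 0 < t → ∀ x, utt t x = ∑ i, uxx i t x + F t x)
    (hf : ∀ s, HasDerivAt f (f' s) s) (hf' : ∀ s, HasDerivAt f' (f'' s) s)
    (hf'' : Continuous f'') (hs : SuppInCone (Ici 0) R u)
    (hF : ContinuousOn (fun y : ℝ × E => F y.1 y.2) (Ici 0 ×ˢ univ))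
    (hFs : SuppInCone (Ici 0) R F) {t : ℝ} (ht : 0 < t) :
    HasDerivAt (fun t => planeAvg ρ f ut t - planeAvg ρ f' u t) (planeAvg ρ f F t) t := by
  have hfc : Continuous f := continuous_iff_continuousAt.2 fun s => (hf s).continuousAt
  have hfc' : Continuous f' := continuous_iff_continuousAt.2 fun s => (hf' s).continuousAt
  have hsub : (Ioi (0 : ℝ) ×ˢ (univ : Set E)) ⊆ Ici 0 ×ˢ univ :=
    prod_mono Ioi_subset_Ici_self Subset.rfl
  have hsu : SuppInCone (Ioi 0) R u := hs.mono Ioi_subset_Ici_self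
  have hsut : SuppInCone (Ioi 0) R ut := hsu.deriv hj.deriv_u
  have d1 := hasDerivAt_planeAvg (ρ := ρ) (hj.cont_ut.mono hsub) hj.cont_utt hj.deriv_ut hf hfc'
    hsut ht
  have d2 := hasDerivAt_planeAvg (ρ := ρ) (hj.cont_u.mono hsub) (hj.cont_ut.mono hsub)
    hj.deriv_u hf' hf'' hsu ht
  refine (d1.sub d2).congr_deriv ?_
  have hsum : ∀ ω : sphere (0 : E) 1, ∑ i, inner ℝ (b i) (ω : E) ^ 2 = 1 := by
    intro ω
    have := b.sum_sq_norm_inner_right (ω : E)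
    simpa using this
  have i1 := integrable_planeAvg (ρ := ρ) hj.cont_utt hfc (hsut.deriv hj.deriv_ut) ht
  have i2 := integrable_planeAvg (ρ := ρ) hj.cont_u hf'' hs ht.le
  have i3 := integrable_planeAvg (ρ := ρ) hF hfc hFs ht.le
  have key : (planeAvg ρ f utt t - planeAvg ρ f'' u t) - planeAvg ρ f F t = 0 := by
    unfold planeAvg
    have i12 : Integrable (fun z : sphere (0 : E) 1 × E => utt t z.2 * f (phase ρ t z)
        - u t z.2 * f'' (phase ρ t z)) ((volume : Measure E).toSphere.prod volume) := i1.sub i2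
    rw [← integral_sub i1 i2, ← integral_sub i12 i3]
    have : ∀ z : sphere (0 : E) 1 × E,
        utt t z.2 * f (phase ρ t z) - u t z.2 * f'' (phase ρ t z) - F t z.2 * f (phase ρ t z)
        = ∑ i, (uxx i t z.2 * f (phase ρ t z)
          - u t z.2 * f'' (phase ρ t z) * inner ℝ (b i) (z.1 : E) ^ 2) := by
      intro z
      rw [Finset.sum_sub_distrib, ← Finset.sum_mul, ← Finset.mul_sum, hsum, eqn t ht]
      ring
    simp only [this]
    rw [integral_finsetSum]
    · exact Finset.sum_eq_zero fun i _ =>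
        hj.integral_laplacian_sub_eq_zero hf hf' hf'' hs ht i
    · intro i _
      have hsx : SuppInCone (Ioi 0) R (ux i) :=
        hsu.lineDeriv fun t ht x => hj.line_u i t ht.le x
      have hsxx : SuppInCone (Ioi 0) R (uxx i) := hsx.lineDeriv (hj.line_ux i)
      have cu : Continuous (u t) := continuous_slice hj.cont_u ht.le
      have cuxx : Continuous (uxx i t) :=
        continuous_slice (hj.cont_uxx i) (show t ∈ Ioi (0 : ℝ) from ht)
      have cph : Continuous fun z : sphere (0 : E) 1 × E => phase ρ t z := by
        unfold phase; fun_prop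
      refine integrable_of_continuous_of_compact (by fun_prop) (isCompact_sphere_prod (t + R))
        fun z hz => ?_
      have := lt_norm_of_notMem hz
      simp [hsxx t ht z.2 this, hsu t ht z.2 this]
  linarith

end Averages

/-! ### Nonexistence for the undamped equation -/

section Nonexistence

/-- Hölder's inequality for a continuous function supported in a ball. -/
theorem rpow_integral_mul_le {E : Type*} [NormedAddCommGroup E] [InnerProductSpace ℝ E]
    [FiniteDimensional ℝ E] [MeasurableSpace E] [BorelSpace E] {p : ℝ} (hp : 1 < p)
    {w φ : E → ℝ} (hw : Continuous w) (hφ : Continuous φ) (hφ0 : ∀ x, 0 ≤ φ x) {r : ℝ}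
    (hs : ∀ x, r < ‖x‖ → w x = 0) :
    (∫ x, |w x| * φ x) ^ p
      ≤ (∫ x, |w x| ^ p) * (∫ x in closedBall (0 : E) r, φ x ^ (p / (p - 1))) ^ (p - 1) := by
  have hp0 : 0 < p := by linarith
  have hp1 : 0 < p - 1 := by linarith
  have hpq : p.HolderConjugate (p / (p - 1)) := Real.HolderConjugate.conjExponent hp
  have hB : IsCompact (closedBall (0 : E) r) := isCompact_closedBall 0 r
  have hfin : IsFiniteMeasure (volume.restrict (closedBall (0 : E) r)) :=
    ⟨by simpa using hB.measure_lt_top⟩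
  have hmem : ∀ {g : E → ℝ} {q : ENNReal}, Continuous g →
      MemLp g q (volume.restrict (closedBall (0 : E) r)) := by
    intro g q hg
    obtain ⟨M, hM⟩ := hB.exists_bound_of_continuousOn hg.continuousOn
    exact MemLp.of_bound hg.aestronglyMeasurable M
      ((ae_restrict_iff' measurableSet_closedBall).2 (Eventually.of_forall hM))
  have hset : ∀ g : E → ℝ, (∀ x, r < ‖x‖ → g x = 0) →
      ∫ x in closedBall (0 : E) r, g x = ∫ x, g x := fun g hg =>
    setIntegral_eq_integral_of_forall_compl_eq_zero fun x hx => hg x (by simpa using hx)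
  have h := integral_mul_le_Lp_mul_Lq_of_nonneg hpq
    (μ := volume.restrict (closedBall (0 : E) r))
    (Eventually.of_forall fun x => abs_nonneg (w x)) (Eventually.of_forall hφ0)
    (hmem hw.abs) (hmem hφ)
  rw [hset _ fun x hx => by simp [hs x hx],
    hset _ fun x hx => by simp [hs x hx, Real.zero_rpow hp0.ne']] at h
  have hI : 0 ≤ ∫ x, |w x| ^ p := integral_nonneg fun x => by positivity
  have hJ : 0 ≤ ∫ x in closedBall (0 : E) r, φ x ^ (p / (p - 1)) :=
    integral_nonneg fun x => Real.rpow_nonneg (hφ0 x) _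
  refine (Real.rpow_le_rpow (integral_nonneg fun x => mul_nonneg (abs_nonneg _) (hφ0 x)) h
    hp0.le).trans (le_of_eq ?_)
  rw [Real.mul_rpow (by positivity) (by positivity), ← Real.rpow_mul hI, ← Real.rpow_mul hJ]
  congr 2
  · rw [one_div_mul_cancel hp0.ne', Real.rpow_one]
  · field_simp

variable {ι E : Type*} [Fintype ι] [NormedAddCommGroup E] [InnerProductSpace ℝ E]

/-- A global classical solution of `u_tt - Δ u = (1 + t) ^ (1 - p) |u| ^ p`, given with its second
order jet, which is supported in the light cone `‖x‖ ≤ t + R` and has nonnegative Cauchy data with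
nontrivial velocity. -/
structure IsConeSolution (b : OrthonormalBasis ι ℝ E) (p R : ℝ) (u ut utt : ℝ → E → ℝ)
    (ux uxt uxx : ι → ℝ → E → ℝ) : Prop extends IsJet b u ut utt ux uxt uxx where
  radius_nonneg : 0 ≤ R
  eqn : ∀ t, 0 < t → ∀ x, utt t x = ∑ i, uxx i t x + (1 + t) ^ (1 - p) * |u t x| ^ p
  supp : SuppInCone (Ici 0) R u
  supp_velocity : ∀ x, R < ‖x‖ → ut 0 x = 0
  nonneg : ∀ x, 0 ≤ u 0 x
  velocity_nonneg : ∀ x, 0 ≤ ut 0 x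
  velocity_ne_zero : ∃ x, ut 0 x ≠ 0

namespace IsConeSolution

variable {b : OrthonormalBasis ι ℝ E} {p R : ℝ} {u ut utt : ℝ → E → ℝ}
  {ux uxt uxx : ι → ℝ → E → ℝ} {f f' f'' : ℝ → ℝ}

theorem continuousOn_source (h : IsConeSolution b p R u ut utt ux uxt uxx) (hp : 1 < p) :
    ContinuousOn (fun y : ℝ × E => (1 + y.1) ^ (1 - p) * |u y.1 y.2| ^ p) (Ici 0 ×ˢ univ) := by
  refine ContinuousOn.mul ?_ (h.cont_u.abs.rpow_const fun _ _ => Or.inr (by linarith))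
  refine ContinuousOn.rpow_const (by fun_prop) fun y hy => Or.inl ?_
  have : 0 ≤ y.1 := hy.1
  positivity

theorem supp_source (h : IsConeSolution b p R u ut utt ux uxt uxx) (hp : 1 < p) :
    SuppInCone (Ici 0) R fun t x => (1 + t) ^ (1 - p) * |u t x| ^ p := fun t ht x hx => by
  change (1 + t) ^ (1 - p) * |u t x| ^ p = 0
  rw [h.supp t ht x hx, abs_zero, Real.zero_rpow (by linarith), mul_zero]

variable [FiniteDimensional ℝ E] [MeasurableSpace E] [BorelSpace E]

/-- The contradiction from a test profile `f` and an intermediate quantity `N` that dominates the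
averages of `u` and is dominated by the average of the source. -/
theorem false_of_bounds [Nontrivial E] (h : IsConeSolution b p R u ut utt ux uxt uxx) (hp : 1 < p)
    (hf : ∀ s, HasDerivAt f (f' s) s) (hf' : ∀ s, HasDerivAt f' (f'' s) s)
    (hf'' : Continuous f'') (hf0 : ∀ s, 0 < f s) (hf'0 : ∀ s, 0 ≤ s → f' s ≤ 0)
    {C : ℝ} (hC : 0 ≤ C) {N : ℝ → ℝ} (hN : ∀ t, 0 < t → 0 ≤ N t)
    (bU : ∀ t, 0 < t → |planeAvg (R + 1) f u t| ≤ C * (1 + t) * N t)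
    (bV : ∀ t, 0 < t → |planeAvg (R + 1) f' u t| ≤ C * N t)
    (bN : ∀ t, 0 < t → N t ^ p ≤ C * (1 + t) * (1 + Real.log (1 + t))
      * planeAvg (R + 1) f (fun t x => (1 + t) ^ (1 - p) * |u t x| ^ p) t) : False := by
  have hfc : Continuous f := continuous_iff_continuousAt.2 fun s => (hf s).continuousAt
  have hfc' : Continuous f' := continuous_iff_continuousAt.2 fun s => (hf' s).continuousAt
  have hsub : (Ioi (0 : ℝ) ×ˢ (univ : Set E)) ⊆ Ici 0 ×ˢ univ :=
    prod_mono Ioi_subset_Ici_self Subset.rfl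
  have hsu : SuppInCone (Ioi 0) R u := h.supp.mono Ioi_subset_Ici_self
  have hsut : SuppInCone (Ici 0) R ut := by
    intro t ht x hx
    rcases eq_or_lt_of_le (show (0 : ℝ) ≤ t from ht) with h0 | h0
    · subst h0
      exact h.supp_velocity x (by simpa using hx)
    · exact hsu.deriv h.deriv_u t h0 x hx
  have hFc := h.continuousOn_source hp
  have cut := continuousOn_planeAvg (ρ := R + 1) h.cont_ut hfc hsut
  have cV := continuousOn_planeAvg (ρ := R + 1) h.cont_u hfc' h.supp
  refine no_global_averages hp hC (cut.sub cV)
    (continuousOn_planeAvg (ρ := R + 1) h.cont_u hfc h.supp) cV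
    (continuousOn_planeAvg (ρ := R + 1) hFc hfc (h.supp_source hp)) ?_ ?_
    (fun t ht => h.toIsJet.hasDerivAt_dual h.eqn hf hf' hf'' h.supp hFc (h.supp_source hp) ht)
    (fun t ht => ?_) hN bU bV bN
  · have i1 := integrable_planeAvg (ρ := R + 1) h.cont_ut hfc hsut (t := 0) self_mem_Ici
    have i2 := integrable_planeAvg (ρ := R + 1) h.cont_u hfc' h.supp (t := 0) self_mem_Ici
    have c1 := continuous_slice (k := fun t (z : sphere (0 : E) 1 × E) =>
      ut t z.2 * f (phase (R + 1) t z)) (continuousOn_mul_phase h.cont_ut hfc)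
      (t := 0) self_mem_Ici
    have c2 := continuous_slice (k := fun t (z : sphere (0 : E) 1 × E) =>
      u t z.2 * f' (phase (R + 1) t z)) (continuousOn_mul_phase h.cont_u hfc')
      (t := 0) self_mem_Ici
    -- positivity of the dual functional at `t = 0`: on the support the phase is positive, so `f' ≤ 0`
    have hnn : ∀ z : sphere (0 : E) 1 × E, u 0 z.2 * f' (phase (R + 1) 0 z) ≤ 0 := by
      intro z
      rcases lt_or_ge R ‖z.2‖ with hz | hz
      · rw [h.supp 0 self_mem_Ici z.2 (by simpa using hz), zero_mul]
      · refine mul_nonpos_of_nonneg_of_nonpos (h.nonneg _) (hf'0 _ ?_)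
        have := (le_abs_self _).trans (abs_inner_sphere_le z.2 z.1)
        unfold phase
        linarith
    have hnn' : ∀ z : sphere (0 : E) 1 × E, 0 ≤ ut 0 z.2 * f (phase (R + 1) 0 z) := fun z =>
      mul_nonneg (h.velocity_nonneg _) (hf0 _).le
    obtain ⟨x, hx⟩ := h.velocity_ne_zero
    obtain ⟨ω⟩ : Nonempty (sphere (0 : E) 1) :=
      (NormedSpace.sphere_nonempty.2 zero_le_one).to_subtype
    change 0 < planeAvg (R + 1) f ut 0 - planeAvg (R + 1) f' u 0
    unfold planeAvg
    rw [← integral_sub i1 i2]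
    refine Continuous.integral_pos_of_hasCompactSupport_nonneg_nonzero (c1.sub c2)
      (HasCompactSupport.intro (isCompact_sphere_prod (0 + R)) fun z hz => ?_)
      (fun z => ?_) (x := (ω, x)) ?_
    · have := lt_norm_of_notMem hz
      simp [hsut 0 self_mem_Ici z.2 this, h.supp 0 self_mem_Ici z.2 this]
    · simp only [Pi.zero_apply]
      linarith [hnn z, hnn' z]
    · have h1 : 0 < ut 0 x * f (phase (R + 1) 0 (ω, x)) :=
        mul_pos (lt_of_le_of_ne (h.velocity_nonneg x) (Ne.symm hx)) (hf0 _)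
      have h2 := hnn (ω, x)
      simp only at h2
      exact ne_of_gt (by linarith)
  · intro t ht
    have : 0 ≤ t := ht
    exact integral_nonneg fun z => mul_nonneg (by positivity) (hf0 _).le
  · have := hasDerivAt_planeAvg (ρ := R + 1) (h.cont_u.mono hsub) (h.cont_ut.mono hsub) h.deriv_u
      hf hfc' hsu ht
    exact this.congr_deriv (by simp only [Pi.sub_apply]; ring)

/-- A lower bound for the profile on the light cone bounds `∫ |u| ^ p` by the averaged source. -/
theorem integral_rpow_le (h : IsConeSolution b p R u ut utt ux uxt uxx) (hp : 1 < p)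
    (hf : Continuous f) {t m : ℝ} (ht : 0 ≤ t)
    (hm : ∀ z : sphere (0 : E) 1 × E, ‖z.2‖ ≤ t + R → m ≤ f (phase (R + 1) t z)) :
    m * (volume : Measure E).toSphere.real univ * ∫ x, |u t x| ^ p
      ≤ (1 + t) ^ (p - 1)
        * planeAvg (R + 1) f (fun t x => (1 + t) ^ (1 - p) * |u t x| ^ p) t := by
  have hp0 : 0 < p := by linarith
  have e1 : ∫ z : sphere (0 : E) 1 × E, |u t z.2| ^ p * m
        ∂((volume : Measure E).toSphere.prod volume)
      = m * (volume : Measure E).toSphere.real univ * ∫ x, |u t x| ^ p := by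
    have := integral_prod_mul (μ := (volume : Measure E).toSphere) (ν := (volume : Measure E))
      (fun _ : sphere (0 : E) 1 => m) (fun x => |u t x| ^ p)
    simp only [integral_const, smul_eq_mul] at this
    rw [mul_comm m, ← this]
    congr 1
    ext z
    ring
  have cu : Continuous fun x => |u t x| ^ p :=
    (continuous_slice h.cont_u ht).abs.rpow_const fun _ => Or.inr hp0.le
  have hz : ∀ z : sphere (0 : E) 1 × E,
      z ∉ (univ : Set (sphere (0 : E) 1)) ×ˢ closedBall (0 : E) (t + R) → |u t z.2| ^ p = 0 := by
    intro z hz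
    rw [h.supp t ht z.2 (lt_norm_of_notMem hz), abs_zero, Real.zero_rpow hp0.ne']
  have cph : Continuous fun z : sphere (0 : E) 1 × E => phase (R + 1) t z := by
    unfold phase; fun_prop
  have ht1 : 0 < 1 + t := by linarith
  have e2 : (1 + t) ^ (p - 1)
        * planeAvg (R + 1) f (fun t x => (1 + t) ^ (1 - p) * |u t x| ^ p) t
      = ∫ z : sphere (0 : E) 1 × E, |u t z.2| ^ p * f (phase (R + 1) t z)
        ∂((volume : Measure E).toSphere.prod volume) := by
    unfold planeAvg
    rw [← integral_const_mul]
    congr 1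
    ext z
    rw [← mul_assoc, ← mul_assoc, ← Real.rpow_add ht1]
    simp
  rw [← e1, e2]
  have cu' : Continuous fun z : sphere (0 : E) 1 × E => |u t z.2| ^ p := cu.comp continuous_snd
  refine integral_mono (integrable_of_continuous_of_compact (cu'.mul continuous_const)
    (isCompact_sphere_prod (t + R)) fun z hz' => by rw [hz z hz', zero_mul])
    (integrable_of_continuous_of_compact (cu'.mul (hf.comp cph))
    (isCompact_sphere_prod (t + R)) fun z hz' => by rw [hz z hz', zero_mul]) fun z => ?_
  by_cases hz' : ‖z.2‖ ≤ t + R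
  · exact mul_le_mul_of_nonneg_left (hm z hz') (by positivity)
  · simp only [h.supp t ht z.2 (not_le.1 hz'), abs_zero, Real.zero_rpow hp0.ne', zero_mul, le_refl]

/-- No global solution for `p ≤ 1 + 2 / d`, by testing with the constant function `1`. -/
theorem false_of_le_two [Nontrivial E] (h : IsConeSolution b p R u ut utt ux uxt uxx) (hp : 1 < p)
    (hd : (Module.finrank ℝ E : ℝ) * (p - 1) ≤ 2) : False := by
  set d := Module.finrank ℝ E with hd'
  have hp0 : 0 < p := by linarith
  set S := (volume : Measure E).toSphere.real univ with hS
  have hS0 : 0 < S := by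
    have : NeZero (volume : Measure E).toSphere := ⟨Measure.toSphere_ne_zero _⟩
    exact measureReal_univ_pos
  set c := (volume : Measure E).real (closedBall (0 : E) 1) with hc
  have hR := h.radius_nonneg
  let N : ℝ → ℝ := fun t => (∫ x, |u t x|) / (1 + t)
  let C : ℝ := S + c ^ (p - 1) * (R + 1) ^ (2 : ℝ) / S
  have hC1 : S ≤ C := le_add_of_nonneg_right (by positivity)
  have hC2 : c ^ (p - 1) * (R + 1) ^ (2 : ℝ) / S ≤ C := le_add_of_nonneg_left hS0.le
  have hN : ∀ t, 0 < t → 0 ≤ N t := fun t ht => by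
    have : 0 ≤ ∫ x, |u t x| := integral_nonneg fun x => abs_nonneg _
    positivity
  refine h.false_of_bounds hp (f := fun _ => 1) (f' := fun _ => 0) (f'' := fun _ => 0)
    (fun s => hasDerivAt_const s _) (fun s => hasDerivAt_const s _) continuous_const
    (fun _ => one_pos) (fun _ _ => le_rfl) (hS0.le.trans hC1) hN (fun t ht => ?_) (fun t ht => ?_)
    (fun t ht => ?_)
  · have e : planeAvg (R + 1) (fun _ => 1) u t = S * ∫ x, u t x := by
      unfold planeAvg
      have := integral_prod_mul (μ := (volume : Measure E).toSphere) (ν := (volume : Measure E))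
        (fun _ : sphere (0 : E) 1 => (1 : ℝ)) (fun x => u t x)
      simp only [integral_const, smul_eq_mul, mul_one, one_mul] at this ⊢
      exact this
    rw [e, abs_mul, abs_of_pos hS0]
    calc S * |∫ x, u t x| ≤ S * ∫ x, |u t x| := by gcongr; exact abs_integral_le_integral_abs
      _ = S * (1 + t) * N t := by simp only [N]; field_simp
      _ ≤ C * (1 + t) * N t := by
        have := hN t ht
        gcongr
  · have := hN t ht
    simp only [planeAvg, mul_zero, integral_zero, abs_zero]
    positivity
  · set W := planeAvg (R + 1) (fun _ => 1) (fun t x => (1 + t) ^ (1 - p) * |u t x| ^ p) t with hW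
    have hlow := h.integral_rpow_le hp (f := fun _ => 1) continuous_const ht.le (m := 1)
      fun _ _ => le_rfl
    rw [one_mul, ← hW, ← hS] at hlow
    have hI0 : 0 ≤ ∫ x, |u t x| ^ p := integral_nonneg fun x => by positivity
    have hW0 : 0 ≤ W := by
      refine integral_nonneg fun z => ?_
      positivity
    have hol := rpow_integral_mul_le hp (continuous_slice h.cont_u ht.le)
      (continuous_const (y := (1 : ℝ))) (fun _ => zero_le_one) (r := t + R)
      (h.supp t ht.le)
    simp only [mul_one, Real.one_rpow, integral_const, MeasurableSet.univ,
      measureReal_restrict_apply, univ_inter, smul_eq_mul] at hol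
    have hvol : (volume : Measure E).real (closedBall (0 : E) (t + R)) = (t + R) ^ d * c := by
      simp only [hc, measureReal_def]
      rw [Measure.addHaar_closedBall' _ _ (by linarith : 0 ≤ t + R), ENNReal.toReal_mul,
        ENNReal.toReal_ofReal (by positivity)]
    rw [hvol] at hol
    have hball : ((t + R) ^ d * c) ^ (p - 1) ≤ ((R + 1) * (1 + t)) ^ (2 : ℝ) * c ^ (p - 1) := by
      rw [Real.mul_rpow (by positivity) (by positivity)]
      gcongr
      have h1 : t + R ≤ (R + 1) * (1 + t) := by nlinarith
      have h2 : 1 ≤ (R + 1) * (1 + t) := by nlinarith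
      calc ((t + R) ^ d) ^ (p - 1) ≤ (((R + 1) * (1 + t)) ^ d) ^ (p - 1) := by
            gcongr
        _ = ((R + 1) * (1 + t)) ^ ((d : ℝ) * (p - 1)) := by
            rw [← Real.rpow_natCast, ← Real.rpow_mul (by positivity)]
        _ ≤ _ := Real.rpow_le_rpow_of_exponent_le h2 hd
    have hlog : 1 ≤ 1 + Real.log (1 + t) := by
      have := Real.log_nonneg (show 1 ≤ 1 + t by linarith)
      linarith
    have hfin : (∫ x, |u t x|) ^ p
        ≤ (1 + t) ^ (p - 1) * W / S * (((R + 1) * (1 + t)) ^ (2 : ℝ) * c ^ (p - 1)) := by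
      refine hol.trans ?_
      gcongr
      rw [le_div_iff₀ hS0]
      linarith
    calc N t ^ p = (∫ x, |u t x|) ^ p / (1 + t) ^ p :=
          Real.div_rpow (integral_nonneg fun x => abs_nonneg _) (by positivity) _
      _ ≤ ((1 + t) ^ (p - 1) * W / S * (((R + 1) * (1 + t)) ^ (2 : ℝ) * c ^ (p - 1)))
            / (1 + t) ^ p := by gcongr
      _ = c ^ (p - 1) * (R + 1) ^ (2 : ℝ) / S * (1 + t) * 1 * W := by
          rw [Real.mul_rpow (by positivity) (by positivity), Real.rpow_sub (by positivity) p 1,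
            Real.rpow_one, Real.rpow_two (1 + t)]
          have : (1 + t) ^ p ≠ 0 := (Real.rpow_pos_of_pos (by positivity) p).ne'
          field_simp
      _ ≤ C * (1 + t) * (1 + Real.log (1 + t)) * W := by
          have : 0 ≤ C := hS0.le.trans hC1
          gcongr

end IsConeSolution

end Nonexistence

/-! ### The profile of the plane waves -/

/-- The profile `s ↦ (1 + s ^ 2) ^ (-β / 2)`, a smooth positive version of `s ^ (-β)`. -/
noncomputable def profile (β s : ℝ) : ℝ := (1 + s ^ 2) ^ (-β / 2)

theorem profile_pos (β s : ℝ) : 0 < profile β s :=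
  Real.rpow_pos_of_pos (by positivity) _

theorem continuous_profile (β : ℝ) : Continuous (profile β) := by
  unfold profile
  exact Continuous.rpow_const (by fun_prop) fun s => Or.inl (by positivity)

theorem hasDerivAt_profile (β s : ℝ) :
    HasDerivAt (profile β) (-β * s * profile (β + 2) s) s := by
  have h1 : HasDerivAt (fun s : ℝ => 1 + s ^ 2) (2 * s) s := by
    simpa using (hasDerivAt_pow 2 s).const_add 1
  refine (h1.rpow_const (p := -β / 2) (Or.inl (by positivity))).congr_deriv ?_
  unfold profile
  rw [show -β / 2 - 1 = -(β + 2) / 2 by ring]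
  ring

theorem hasDerivAt_deriv_profile (β s : ℝ) :
    HasDerivAt (fun s => -β * s * profile (β + 2) s)
      (-β * profile (β + 2) s + -β * s * (-(β + 2) * s * profile (β + 2 + 2) s)) s := by
  have h := ((hasDerivAt_id s).const_mul (-β)).mul (hasDerivAt_profile (β + 2) s)
  exact h.congr_deriv (by simp)

theorem sqrt_mul_profile_add_one (β s : ℝ) :
    √(1 + s ^ 2) * profile (β + 1) s = profile β s := by
  unfold profile
  rw [Real.sqrt_eq_rpow, ← Real.rpow_add (by positivity)]
  ring_nf

theorem profile_le_rpow {γ s : ℝ} (hγ : 0 ≤ γ) (hs : 0 < s) : profile γ s ≤ s ^ (-γ) := by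
  unfold profile
  calc (1 + s ^ 2) ^ (-γ / 2) ≤ (s ^ 2) ^ (-γ / 2) :=
        Real.rpow_le_rpow_of_nonpos (by positivity) (by linarith) (by linarith)
    _ = s ^ (-γ) := by
        rw [← Real.rpow_natCast, ← Real.rpow_mul hs.le]
        congr 1
        push_cast
        ring

theorem abs_deriv_profile_le {β : ℝ} (hβ : 0 ≤ β) (s : ℝ) :
    |-β * s * profile (β + 2) s| ≤ β * profile (β + 1) s := by
  have h1 : √(1 + s ^ 2) * profile (β + 2) s = profile (β + 1) s := by
    have := sqrt_mul_profile_add_one (β + 1) s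
    rwa [show β + 1 + 1 = β + 2 by ring] at this
  have h2 : |s| ≤ √(1 + s ^ 2) := Real.abs_le_sqrt (by linarith)
  rw [abs_mul, abs_mul, abs_neg, abs_of_nonneg hβ, abs_of_pos (profile_pos _ _), ← h1, mul_assoc]
  have := (profile_pos (β + 2) s).le
  gcongr

/-! ### Averaged plane waves -/

/-- The phase lies in `[1, 2 τ]`, `τ = t + R + 1`, on the light cone. -/
theorem phase_mem {E : Type*} [NormedAddCommGroup E] [InnerProductSpace ℝ E] {t R : ℝ}
    {z : sphere (0 : E) 1 × E} (hz : ‖z.2‖ ≤ t + R) :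
    1 ≤ phase (R + 1) t z ∧ phase (R + 1) t z ≤ 2 * (t + R + 1) := by
  have := abs_le.1 (abs_inner_sphere_le z.2 z.1)
  unfold phase
  constructor <;> linarith [this.1, this.2]

section PlaneWave

variable {E : Type*} [NormedAddCommGroup E] [InnerProductSpace ℝ E]
  [FiniteDimensional ℝ E] [MeasurableSpace E] [BorelSpace E]

/-- The superposition over all directions of the plane waves with profile `profile γ`; the measure
on the sphere is not normalized. -/
noncomputable def planeWave (γ ρ t : ℝ) (x : E) : ℝ :=
  ∫ ω : sphere (0 : E) 1, profile γ (phase ρ t (ω, x)) ∂(volume : Measure E).toSphere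

theorem planeWave_nonneg (γ ρ t : ℝ) (x : E) : 0 ≤ planeWave γ ρ t x :=
  integral_nonneg fun _ => (profile_pos _ _).le

theorem continuous_planeWave (γ ρ t : ℝ) : Continuous (planeWave γ ρ t : E → ℝ) := by
  have h := continuous_parametric_integral_of_continuous (μ := (volume : Measure E).toSphere)
    (f := fun (x : E) (ω : sphere (0 : E) 1) => profile γ (phase ρ t (ω, x)))
    ((continuous_profile γ).comp (by unfold phase; fun_prop)) isCompact_univ
  simp only [Measure.restrict_univ] at h
  exact h

/-- The `q`-th power of the averaged wave with `γ = κ + 1 / q`, `κ = (d - 1) / 2`, integrated over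
the light cone at time `t`: the exponent is the one where a logarithm appears. -/
theorem exists_integral_planeWave_rpow_le [Nontrivial E] {q : ℝ} (hq0 : 0 < q) {R : ℝ}
    (hR : 0 ≤ R) :
    ∃ C : ℝ, 0 ≤ C ∧ ∀ t : ℝ, 0 < t → ∫ x in closedBall (0 : E) (t + R),
      planeWave (((Module.finrank ℝ E : ℝ) - 1) / 2 + 1 / q) (R + 1) t x ^ q
        ≤ C * ((t + R + 1) ^ (((Module.finrank ℝ E : ℝ) - 1) * (1 - q / 2))
          * Real.log (t + R + 1)) := by
  set κ := ((Module.finrank ℝ E : ℝ) - 1) / 2 with hκ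
  have hκ0 : 0 ≤ κ := by
    have : (1 : ℝ) ≤ Module.finrank ℝ E := by exact_mod_cast Module.finrank_pos (R := ℝ) (M := E)
    rw [hκ]; linarith
  set δ := 1 / q with hδ
  have hδ0 : 0 < δ := by positivity
  have hδq : δ * q = 1 := one_div_mul_cancel hq0.ne'
  obtain ⟨C₁, hC₁0, hC₁⟩ := exists_integral_sphere_rpow_le (E := E) hδ0
  obtain ⟨C₂, hC₂0, hC₂⟩ := exists_integral_ball_inv_le (E := E)
  refine ⟨C₁ ^ q * C₂, by positivity, fun t ht => ?_⟩
  set τ := t + R + 1 with hτdef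
  have hτ1 : 1 ≤ τ := by linarith
  have hB := isCompact_closedBall (0 : E) (t + R)
  have hpos : ∀ x ∈ closedBall (0 : E) (t + R), 0 < τ - ‖x‖ := fun x hx => by
    have hx' : ‖x‖ ≤ t + R := by simpa using hx
    linarith
  have hle : ∀ x ∈ closedBall (0 : E) (t + R),
      planeWave (κ + δ) (R + 1) t x ≤ C₁ * τ ^ (-κ) * (τ - ‖x‖) ^ (-δ) := by
    intro x hx
    have hx' := hpos x hx
    refine le_trans ?_ (hC₁ τ (by linarith) x (by linarith))
    have hpos : ∀ ω : sphere (0 : E) 1, 0 < τ - inner ℝ x (ω : E) := fun ω => by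
      have := (le_abs_self _).trans (abs_inner_sphere_le x ω)
      linarith
    have hc1 : Continuous fun ω : sphere (0 : E) 1 =>
        profile (κ + δ) (phase (R + 1) t (ω, x)) := by
      refine (continuous_profile _).comp ?_
      unfold phase
      fun_prop
    have hc2 : Continuous fun ω : sphere (0 : E) 1 => (τ - inner ℝ x (ω : E)) ^ (-(κ + δ)) :=
      Continuous.rpow_const (by fun_prop) fun ω => Or.inl (hpos ω).ne'
    refine integral_mono (integrable_of_continuous_of_compact hc1 isCompact_univ (by simp))
      (integrable_of_continuous_of_compact hc2 isCompact_univ (by simp)) fun ω => ?_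
    have e : phase (R + 1) t (ω, x) = τ - inner ℝ x (ω : E) := by
      unfold phase; rw [hτdef]; ring
    simp only [e]
    exact profile_le_rpow (by positivity) (hpos ω)
  have hstep : ∀ x ∈ closedBall (0 : E) (t + R),
      planeWave (κ + δ) (R + 1) t x ^ q ≤ C₁ ^ q * τ ^ (-(κ * q)) * (τ - ‖x‖)⁻¹ := by
    intro x hx
    have h1 := hpos x hx
    calc planeWave (κ + δ) (R + 1) t x ^ q ≤ (C₁ * τ ^ (-κ) * (τ - ‖x‖) ^ (-δ)) ^ q :=
          Real.rpow_le_rpow (planeWave_nonneg _ _ _ _) (hle x hx) hq0.le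
      _ = _ := by
        rw [Real.mul_rpow (by positivity) (by positivity), Real.mul_rpow hC₁0 (by positivity),
          ← Real.rpow_mul (by positivity), ← Real.rpow_mul h1.le, neg_mul, neg_mul, hδq,
          Real.rpow_neg_one]
  calc _ ≤ ∫ x in closedBall (0 : E) (t + R), C₁ ^ q * τ ^ (-(κ * q)) * (τ - ‖x‖)⁻¹ := by
        refine setIntegral_mono_on ?_ ?_ measurableSet_closedBall hstep
        · exact ((continuous_planeWave _ _ t).rpow_const
            fun _ => Or.inr hq0.le).continuousOn.integrableOn_compact hB
        · refine ContinuousOn.integrableOn_compact hB (continuousOn_const.mul ?_)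
          exact ContinuousOn.inv₀ (by fun_prop) fun x hx => (hpos x hx).ne'
    _ ≤ C₁ ^ q * τ ^ (-(κ * q)) * (C₂ * τ ^ (2 * κ) * Real.log τ) := by
        rw [integral_const_mul]
        have h2 := hC₂ τ hτ1
        rw [show τ - 1 = t + R by rw [hτdef]; ring,
          show (Module.finrank ℝ E : ℝ) - 1 = 2 * κ by rw [hκ]; ring] at h2
        gcongr
    _ = _ := by
        rw [show ((Module.finrank ℝ E : ℝ) - 1) * (1 - q / 2) = -(κ * q) + 2 * κ by rw [hκ]; ring,
          Real.rpow_add (by linarith)]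
        ring

end PlaneWave

/-! ### The Strauss range -/

section StraussRange

namespace IsConeSolution

variable {ι E : Type*} [Fintype ι] [NormedAddCommGroup E] [InnerProductSpace ℝ E]
  [FiniteDimensional ℝ E] [MeasurableSpace E] [BorelSpace E]
  {b : OrthonormalBasis ι ℝ E} {p R : ℝ} {u ut utt : ℝ → E → ℝ} {ux uxt uxx : ι → ℝ → E → ℝ}

/-- The bound of `integral_rpow_le` for the profile with exponent `β`. -/
theorem integral_rpow_le_of_profile [Nontrivial E] (h : IsConeSolution b p R u ut utt ux uxt uxx)
    (hp : 1 < p) {β : ℝ} (hβ0 : 0 ≤ β) {t : ℝ} (ht : 0 < t) :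
    ∫ x, |u t x| ^ p ≤ 9 ^ (β / 2) / (volume : Measure E).toSphere.real univ
      * (t + R + 1) ^ (p - 1 + β)
      * planeAvg (R + 1) (profile β) (fun t x => (1 + t) ^ (1 - p) * |u t x| ^ p) t := by
  have hR := h.radius_nonneg
  set S := (volume : Measure E).toSphere.real univ with hS
  have hS0 : 0 < S := by
    have : NeZero (volume : Measure E).toSphere := ⟨Measure.toSphere_ne_zero _⟩
    exact measureReal_univ_pos
  set W := planeAvg (R + 1) (profile β) (fun t x => (1 + t) ^ (1 - p) * |u t x| ^ p) t with hW
  have hW0 : 0 ≤ W := integral_nonneg fun z =>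
    mul_nonneg (by positivity) (profile_pos _ _).le
  set τ := t + R + 1 with hτdef
  have hτ1 : 1 ≤ τ := by linarith
  have hτ0 : 0 < τ := by linarith
  have hlow := h.integral_rpow_le hp (continuous_profile β) ht.le (m := (9 * τ ^ 2) ^ (-β / 2))
    fun z hz => by
      obtain ⟨h1, h2⟩ := phase_mem hz
      unfold profile
      refine Real.rpow_le_rpow_of_nonpos (by positivity) ?_ (by linarith)
      nlinarith
  rw [← hW, ← hS] at hlow
  have e1 : (9 * τ ^ 2) ^ (-β / 2) = (9 ^ (β / 2) * τ ^ β)⁻¹ := by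
    rw [neg_div, Real.rpow_neg (by positivity), Real.mul_rpow (by norm_num) (by positivity),
      ← Real.rpow_natCast, ← Real.rpow_mul hτ0.le]
    congr 3
    push_cast
    ring
  rw [e1, mul_assoc, inv_mul_le_iff₀ (by positivity)] at hlow
  have h1 : (1 + t) ^ (p - 1) ≤ τ ^ (p - 1) :=
    Real.rpow_le_rpow (by positivity) (by linarith) (by linarith)
  calc ∫ x, |u t x| ^ p = (S * ∫ x, |u t x| ^ p) / S := by field_simp
    _ ≤ (9 ^ (β / 2) * τ ^ β * (τ ^ (p - 1) * W)) / S := by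
      refine div_le_div_of_nonneg_right (hlow.trans ?_) hS0.le
      gcongr
    _ = _ := by rw [Real.rpow_add hτ0]; ring

/-- No global solution when `(d + 1) p (p - 1) ≤ 2 p + 2`, by testing with the averaged plane
waves of profile `profile β`, evaluated at `t + R + 1 - ⟪x, ω⟫`, with `β = (d - 1) / 2 - 1 / p`. For this `β` the dual weight of
Hölder's inequality is `(τ - ‖x‖)⁻¹`, which integrates to a logarithm; the factor `(log τ) ^ (p - 1)`
is affordable as `p ≤ 2`. -/
theorem false_of_le_strauss [Nontrivial E] (h : IsConeSolution b p R u ut utt ux uxt uxx)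
    (hp : 1 < p) (hp2 : p ≤ 2) (hβ : 1 / p ≤ ((Module.finrank ℝ E : ℝ) - 1) / 2)
    (hs : ((Module.finrank ℝ E : ℝ) + 1) * (p - 1) / 2 - 1 / p ≤ 1) : False := by
  set κ := ((Module.finrank ℝ E : ℝ) - 1) / 2 with hκ
  have hp0 : 0 < p := by linarith
  have hp1 : 0 < p - 1 := by linarith
  have hR := h.radius_nonneg
  set β := κ - 1 / p with hβdef
  have hβ0 : 0 ≤ β := by linarith
  set δ := (p - 1) / p with hδ
  have hδ0 : 0 < δ := by positivity
  have hβδ : β + 1 = κ + δ := by rw [hβdef, hδ]; field_simp; ring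
  set σ := (volume : Measure E).toSphere with hσ
  set S := σ.real univ with hS
  have hS0 : 0 < S := by
    have : NeZero σ := ⟨Measure.toSphere_ne_zero _⟩
    exact measureReal_univ_pos
  set q := p / (p - 1) with hq
  have hq0 : 0 < q := by positivity
  have hδq : 1 / q = δ := by rw [hδ, hq]; field_simp
  have h2κ : (Module.finrank ℝ E : ℝ) - 1 = 2 * κ := by rw [hκ]; ring
  obtain ⟨C₁, hC₁, hwave⟩ := exists_integral_planeWave_rpow_le (E := E) hq0 hR
  rw [← hκ, hδq, ← hβδ, h2κ] at hwave
  let N : ℝ → ℝ := planeAvg (R + 1) (profile (β + 1)) fun t x => |u t x|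
  have hN : ∀ t, 0 < t → 0 ≤ N t := fun t _ =>
    integral_nonneg fun z => mul_nonneg (abs_nonneg _) (profile_pos _ _).le
  have cabs : ContinuousOn (fun y : ℝ × E => |u y.1 y.2|) (Ici 0 ×ˢ univ) := h.cont_u.abs
  have sabs : SuppInCone (Ici 0) R fun t x => |u t x| := fun t ht x hx => by
    change |u t x| = 0
    rw [h.supp t ht x hx, abs_zero]
  have cf' : Continuous fun s => -β * s * profile (β + 2) s := by
    have := continuous_profile (β + 2)
    fun_prop
  have hτ : ∀ t : ℝ, 0 < t → t + R + 1 ≤ (R + 1) * (1 + t) := fun t ht => by nlinarith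
  -- a bound for the pairing with any profile dominated by `profile (β + 1)` on the light cone
  have hpair : ∀ {g : ℝ → ℝ} {K t : ℝ}, Continuous g → 0 < t → 0 ≤ K →
      (∀ s, 1 ≤ s → s ≤ 2 * (t + R + 1) → |g s| ≤ K * profile (β + 1) s) →
      |planeAvg (R + 1) g u t| ≤ K * N t := by
    intro g K t hg ht hK hb
    have ht' : t ∈ Ici (0 : ℝ) := ht.le
    simp only [N, planeAvg]
    rw [← integral_const_mul]
    refine abs_integral_le_integral_abs.trans (integral_mono
      (integrable_planeAvg h.cont_u hg h.supp ht').abs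
      ((integrable_planeAvg cabs (continuous_profile _) sabs ht').const_mul K) fun z => ?_)
    simp only
    rw [abs_mul]
    by_cases hz : ‖z.2‖ ≤ t + R
    · obtain ⟨h1, h2⟩ := phase_mem hz
      calc _ ≤ |u t z.2| * (K * profile (β + 1) (phase (R + 1) t z)) := by
            gcongr
            exact hb _ h1 h2
        _ = _ := by ring
    · rw [h.supp t ht' z.2 (not_le.1 hz)]
      simp
  -- Fubini
  have hNΨ : ∀ t, 0 < t → N t = ∫ x, |u t x| * planeWave (β + 1) (R + 1) t x := by
    intro t ht
    have hi := integrable_planeAvg (ρ := R + 1) cabs (continuous_profile (β + 1)) sabs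
      (show t ∈ Ici (0 : ℝ) from ht.le)
    simp only [N, planeAvg]
    rw [integral_prod_symm _ hi]
    congr 1
    ext x
    simp only [planeWave]
    rw [integral_const_mul]
  let C₃ : ℝ := 9 ^ (β / 2) / S * C₁ ^ (p - 1)
  have hC₃ : 0 ≤ C₃ := by positivity
  let C : ℝ := 3 * (R + 1) + β + C₃ * (R + 1) * (1 + Real.log (R + 1))
  have hlogR : 0 ≤ Real.log (R + 1) := Real.log_nonneg (by linarith)
  have hCb : 0 ≤ C₃ * (R + 1) * (1 + Real.log (R + 1)) := by positivity
  have hCU : 3 * (R + 1) ≤ C := by simp only [C]; linarith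
  have hCV : β ≤ C := by simp only [C]; linarith
  have hCN : C₃ * (R + 1) * (1 + Real.log (R + 1)) ≤ C := by simp only [C]; linarith
  refine h.false_of_bounds hp (f := profile β) (hasDerivAt_profile β)
    (hasDerivAt_deriv_profile β) ?_ (profile_pos β) (fun s h0 => ?_) (hβ0.trans hCV) hN
    (fun t ht => ?_) (fun t ht => ?_) (fun t ht => ?_)
  · have := continuous_profile (β + 2)
    have := continuous_profile (β + 2 + 2)
    fun_prop
  · have := profile_pos (β + 2) s
    rw [mul_assoc, neg_mul]
    exact neg_nonpos.2 (by positivity)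
  · refine (hpair (K := 3 * (t + R + 1)) (continuous_profile β) ht (by positivity)
      fun s h1 h2 => ?_).trans ?_
    · rw [abs_of_pos (profile_pos _ _), ← sqrt_mul_profile_add_one]
      refine mul_le_mul_of_nonneg_right ?_ (profile_pos _ _).le
      refine Real.sqrt_le_iff.2 ⟨by positivity, ?_⟩
      nlinarith
    · refine mul_le_mul_of_nonneg_right ?_ (hN t ht)
      have := hτ t ht
      calc 3 * (t + R + 1) ≤ 3 * (R + 1) * (1 + t) := by linarith
        _ ≤ C * (1 + t) := by gcongr
  · exact (hpair cf' ht hβ0 fun s _ _ => abs_deriv_profile_le hβ0 s).trans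
      (mul_le_mul_of_nonneg_right hCV (hN t ht))
  · set W := planeAvg (R + 1) (profile β) (fun t x => (1 + t) ^ (1 - p) * |u t x| ^ p) t with hW
    have hW0 : 0 ≤ W := integral_nonneg fun z =>
      mul_nonneg (by positivity) (profile_pos _ _).le
    set τ := t + R + 1 with hτdef
    have hτ1 : 1 ≤ τ := by linarith
    have hτ0 : 0 < τ := by linarith
    have hlogτ : 0 ≤ Real.log τ := Real.log_nonneg hτ1
    have hI0 : 0 ≤ ∫ x, |u t x| ^ p := integral_nonneg fun x => by positivity
    have hIle : ∫ x, |u t x| ^ p ≤ 9 ^ (β / 2) / S * τ ^ (p - 1 + β) * W :=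
      h.integral_rpow_le_of_profile hp hβ0 ht
    have hJle : (∫ x in closedBall (0 : E) (t + R),
        planeWave (β + 1) (R + 1) t x ^ q) ^ (p - 1)
        ≤ C₁ ^ (p - 1) * τ ^ ((2 * κ * (1 - q / 2)) * (p - 1)) * (1 + Real.log τ) := by
      have h1 : Real.log τ ^ (p - 1) ≤ 1 + Real.log τ := by
        calc Real.log τ ^ (p - 1) ≤ (1 + Real.log τ) ^ (p - 1) := by gcongr; linarith
          _ ≤ (1 + Real.log τ) ^ (1 : ℝ) :=
            Real.rpow_le_rpow_of_exponent_le (by linarith) (by linarith)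
          _ = _ := Real.rpow_one _
      calc _ ≤ (C₁ * (τ ^ (2 * κ * (1 - q / 2)) * Real.log τ)) ^ (p - 1) := by
            refine Real.rpow_le_rpow (integral_nonneg fun x => Real.rpow_nonneg
              (planeWave_nonneg _ _ _ _) _) (hwave t ht) hp1.le
        _ = C₁ ^ (p - 1) * τ ^ ((2 * κ * (1 - q / 2)) * (p - 1)) * Real.log τ ^ (p - 1) := by
            rw [Real.mul_rpow (by positivity) (by positivity),
              Real.mul_rpow (by positivity) hlogτ, ← Real.rpow_mul hτ0.le]
            ring
        _ ≤ _ := by gcongr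
    have hol := rpow_integral_mul_le hp (continuous_slice h.cont_u ht.le)
      (continuous_planeWave (β + 1) (R + 1) t) (planeWave_nonneg (β + 1) (R + 1) t)
      (r := t + R) (h.supp t ht.le)
    rw [← hNΨ t ht] at hol
    -- the total power of `τ`, at most `1` precisely in the Strauss range
    have hexp : p - 1 + β + (2 * κ * (1 - q / 2)) * (p - 1) ≤ 1 := by
      have e1 : q * (p - 1) = p := by rw [hq]; field_simp
      have e2 : p - 1 + β + (2 * κ * (1 - q / 2)) * (p - 1)
          = ((Module.finrank ℝ E : ℝ) + 1) * (p - 1) / 2 - 1 / p := by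
        rw [show 2 * κ * (1 - q / 2) * (p - 1) = 2 * κ * (p - 1) - κ * (q * (p - 1)) by ring, e1,
          hβdef, hκ]
        ring
      linarith
    have hτpow : τ ^ (p - 1 + β) * τ ^ ((2 * κ * (1 - q / 2)) * (p - 1)) ≤ τ := by
      rw [← Real.rpow_add hτ0]
      calc _ ≤ τ ^ (1 : ℝ) := Real.rpow_le_rpow_of_exponent_le hτ1 hexp
        _ = τ := Real.rpow_one _
    have hlog1 : 0 ≤ Real.log (1 + t) := Real.log_nonneg (by linarith)
    have hlog : 1 + Real.log τ ≤ (1 + Real.log (R + 1)) * (1 + Real.log (1 + t)) := by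
      have : Real.log τ ≤ Real.log (R + 1) + Real.log (1 + t) := by
        rw [← Real.log_mul (by linarith) (by linarith)]
        exact Real.log_le_log hτ0 (hτ t ht)
      nlinarith
    calc N t ^ p ≤ (9 ^ (β / 2) / S * τ ^ (p - 1 + β) * W) * (C₁ ^ (p - 1)
          * τ ^ ((2 * κ * (1 - q / 2)) * (p - 1)) * (1 + Real.log τ)) := by
          refine hol.trans (mul_le_mul hIle hJle (Real.rpow_nonneg (integral_nonneg fun x =>
            Real.rpow_nonneg (planeWave_nonneg _ _ _ _) _) _) (by positivity))
      _ = C₃ * (τ ^ (p - 1 + β) * τ ^ ((2 * κ * (1 - q / 2)) * (p - 1))) * (1 + Real.log τ) * W := by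
          simp only [C₃]; ring
      _ ≤ C₃ * ((R + 1) * (1 + t)) * ((1 + Real.log (R + 1)) * (1 + Real.log (1 + t))) * W := by
          have := hτpow.trans (hτ t ht)
          gcongr
      _ = C₃ * (R + 1) * (1 + Real.log (R + 1)) * (1 + t) * (1 + Real.log (1 + t)) * W := by ring
      _ ≤ C * (1 + t) * (1 + Real.log (1 + t)) * W := by gcongr

end IsConeSolution

end StraussRange

/-! ### The Liouville transform -/

section Liouville

variable {ι E : Type*} [Fintype ι] [NormedAddCommGroup E] [InnerProductSpace ℝ E]

/-- The jet of `u = (1 + t) v`. -/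
theorem IsJet.one_add_mul {b : OrthonormalBasis ι ℝ E} {v vt vtt : ℝ → E → ℝ}
    {vx vxt vxx : ι → ℝ → E → ℝ} (h : IsJet b v vt vtt vx vxt vxx) :
    IsJet b (fun t x => (1 + t) * v t x) (fun t x => (1 + t) * vt t x + v t x)
      (fun t x => (1 + t) * vtt t x + 2 * vt t x) (fun i t x => (1 + t) * vx i t x)
      (fun i t x => (1 + t) * vxt i t x + vx i t x) (fun i t x => (1 + t) * vxx i t x) := by
  have hS : (Ioi 0 ×ˢ univ : Set (ℝ × E)) ⊆ Ici 0 ×ˢ univ :=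
    prod_mono Ioi_subset_Ici_self Subset.rfl
  have hc : ∀ s : Set (ℝ × E), ContinuousOn (fun z : ℝ × E => 1 + z.1) s := fun s => by fun_prop
  have hd : ∀ t : ℝ, HasDerivAt (fun s : ℝ => 1 + s) 1 t := fun t =>
    (hasDerivAt_id t).const_add 1
  exact
  { cont_u := (hc _).mul h.cont_u
    cont_ut := ((hc _).mul h.cont_ut).add h.cont_u
    cont_ux := fun i => (hc _).mul (h.cont_ux i)
    cont_utt := ((hc _).mul h.cont_utt).add (continuousOn_const.mul (h.cont_ut.mono hS))
    cont_uxt := fun i => ((hc _).mul (h.cont_uxt i)).add ((h.cont_ux i).mono hS)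
    cont_uxx := fun i => (hc _).mul (h.cont_uxx i)
    deriv_u := fun t ht x =>
      ((hd t).fun_mul (h.deriv_u t ht x)).congr_deriv (by ring)
    deriv_ut := fun t ht x =>
      (((hd t).fun_mul (h.deriv_ut t ht x)).fun_add (h.deriv_u t ht x)).congr_deriv (by ring)
    deriv_ux := fun i t ht x =>
      ((hd t).fun_mul (h.deriv_ux i t ht x)).congr_deriv (by ring)
    line_u := fun i t ht x => (HasDerivAt.const_mul (1 + t) (h.line_u i t ht x) :)
    line_ut := fun i t ht x =>
      ((HasDerivAt.const_mul (1 + t) (h.line_ut i t ht x)).add (h.line_u i t ht.le x) :)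
    line_ux := fun i t ht x => (HasDerivAt.const_mul (1 + t) (h.line_ux i t ht x) :) }

/-- On a bounded part of space-time the nonlinearity is dominated by `|u|`. -/
theorem exists_source_le [FiniteDimensional ℝ E] {p : ℝ} (hp : 1 < p) {u : ℝ → E → ℝ}
    (hu : ContinuousOn (fun z : ℝ × E => u z.1 z.2) (Ici 0 ×ˢ univ)) (T : ℝ) :
    ∃ M, ∀ t ∈ Ioc 0 T, ∀ x, ‖x‖ ≤ T → |(1 + t) ^ (1 - p) * |u t x| ^ p| ≤ M * |u t x| := by
  obtain ⟨K, hK⟩ := (isCompact_Icc.prod (isCompact_closedBall (0 : E) T)).exists_bound_of_continuousOn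
    (hu.mono (prod_mono (Icc_subset_Ici_self : Icc 0 T ⊆ Ici 0) (subset_univ _)))
  refine ⟨K ^ (p - 1), fun t ht x hx => ?_⟩
  have h1 : |u t x| ≤ K := hK (t, x) ⟨⟨ht.1.le, ht.2⟩, mem_closedBall_zero_iff.2 hx⟩
  have h2 : (1 + t) ^ (1 - p) ≤ 1 :=
    Real.rpow_le_one_of_one_le_of_nonpos (by linarith [ht.1]) (by linarith)
  have h3 : |u t x| ^ p = |u t x| ^ (p - 1) * |u t x| := by
    rw [← Real.rpow_add_one' (abs_nonneg _) (by linarith), sub_add_cancel]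
  have h4 : 0 ≤ (1 + t) ^ (1 - p) := Real.rpow_nonneg (by linarith [ht.1]) _
  rw [abs_of_nonneg (by positivity), h3, ← mul_assoc]
  have h5 : |u t x| ^ (p - 1) ≤ K ^ (p - 1) :=
    Real.rpow_le_rpow (abs_nonneg _) h1 (by linarith)
  have h6 : 0 ≤ |u t x| ^ (p - 1) := by positivity
  gcongr
  calc _ ≤ 1 * |u t x| ^ (p - 1) := by gcongr
    _ ≤ _ := by rwa [one_mul]

end Liouville

/-! ### The critical exponent -/

/-- Above `1 + 2 / n` the bound `p ≤ p₂(n)` is the quadratic inequality for the Strauss exponent in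
dimension `n + 2`. -/
theorem quadratic_nonpos_of_le_criticalExponent {n : ℕ} (hn : 1 ≤ n) {p : ℝ} (hp : 1 < p)
    (hpc : p ≤ criticalExponent n) (hn2 : 2 < n * (p - 1)) :
    ((n : ℝ) + 1) * p ^ 2 - (n + 3) * p - 2 ≤ 0 := by
  have hn0 : (1 : ℝ) ≤ n := by exact_mod_cast hn
  have h1 : 1 + 2 / (n : ℝ) < p := by
    have : 2 / (n : ℝ) < p - 1 := by rw [div_lt_iff₀ (by linarith)]; linarith
    linarith
  have h2 : p ≤ straussExponent (n + 2) := (le_max_iff.1 hpc).resolve_right (not_le.2 h1)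
  obtain ⟨hq0, hq⟩ := (straussExponent_iff (m := (n : ℝ) + 2) (by linarith) _).2 rfl
  set q := straussExponent ((n : ℝ) + 2)
  by_contra! hcon
  have h3 : ((n : ℝ) + 1) * q ^ 2 - (n + 3) * q - 2 = 0 := by linarith
  -- On the positive half-line `s ↦ (n + 1) s - (n + 3) - 2 / s` is increasing.
  have h4 : 0 < ((n : ℝ) + 1) * p - (n + 3) := by nlinarith
  nlinarith [mul_nonneg (sub_nonneg.2 h2) hq0.le, mul_nonneg (sub_nonneg.2 h2) h4.le]

/-- The Strauss exponent in dimension `n + 2` exceeds `1 + 2 / n` only for `n ≥ 3`, where it is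
at most `2`. -/
theorem three_le_and_le_two {n : ℕ} (hn : 1 ≤ n) {p : ℝ} (hp : 1 < p)
    (hn2 : 2 < n * (p - 1)) (hq : ((n : ℝ) + 1) * p ^ 2 - (n + 3) * p - 2 ≤ 0) :
    3 ≤ n ∧ p ≤ 2 := by
  have h3 : 3 ≤ n := by
    by_contra! hlt
    interval_cases n <;> norm_num at hn2 hq <;> nlinarith
  refine ⟨h3, ?_⟩
  have : (3 : ℝ) ≤ n := by exact_mod_cast h3
  by_contra! h2
  nlinarith [mul_pos (sub_pos.2 h2) (sub_pos.2 hp), mul_pos (sub_pos.2 h2) (by linarith : (0 : ℝ) < n)]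

end DampedWave

open DampedWave Set Metric in
theorem theorem1 (n : ℕ) (hn : 1 ≤ n) (p : ℝ) (hp : 1 < p) (hp₂ : p ≤ criticalExponent n)
    (v₀ v₁ : EuclideanSpace ℝ (Fin n) → ℝ)
    (hv₀ : ContDiff ℝ 2 v₀) (hv₀c : HasCompactSupport v₀)
    (hv₁ : ContDiff ℝ 1 v₁) (hv₁c : HasCompactSupport v₁)
    (hv₀_nonneg : ∀ x, 0 ≤ v₀ x) (hv₁_nonneg : ∀ x, 0 ≤ v₁ x)
    (hne : ¬ (v₀ = 0 ∧ v₁ = 0))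
    (T : EReal) (hT : 0 < T) (v : ℝ → EuclideanSpace ℝ (Fin n) → ℝ)
    (hv : IsClassicalSolution n p T v₀ v₁ v) :
    T < ⊤ := by
  rw [lt_top_iff_ne_top]
  rintro rfl
  have hI : timeInterval ⊤ = Ici 0 := by
    ext t
    simp [timeInterval, EReal.coe_lt_top]
  obtain ⟨hc, heq, hv0, hv1⟩ := hv
  rw [hI] at hc heq hv1
  have hn0 : (1 : ℝ) ≤ n := by exact_mod_cast hn
  obtain ⟨vt, vtt, vx, vxt, vxx, hj, e1, e2, e3⟩ :=
    exists_isJet (EuclideanSpace.basisFun (Fin n) ℝ) hc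
  have hJ := hj.one_add_mul
  have hvt0 : ∀ x, vt 0 x = v₁ x := fun x => by rw [← e1 0 le_rfl, hv1]
  have heqn : ∀ t : ℝ, 0 < t → ∀ x, (1 + t) * vtt t x + 2 * vt t x
      = ∑ i, (1 + t) * vxx i t x + (1 + t) ^ (1 - p) * |(1 + t) * v t x| ^ p := by
    intro t ht x
    have ht1 : 0 < 1 + t := by linarith
    have h := heq t ht.le x
    rw [e2 t ht, e3 t ht, e1 t ht.le] at h
    have hs : (1 + t) ^ (1 - p) * |(1 + t) * v t x| ^ p = (1 + t) * |v t x| ^ p := by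
      rw [abs_mul, abs_of_pos ht1, Real.mul_rpow ht1.le (abs_nonneg _), ← mul_assoc,
        ← Real.rpow_add ht1, sub_add_cancel, Real.rpow_one]
    rw [hs, ← Finset.mul_sum, ← h]
    field_simp
    ring
  obtain ⟨R₀, hR₀⟩ := ((hv₀c.isCompact.union hv₁c.isCompact).isBounded).subset_closedBall 0
  set R := max R₀ 0 with hR
  have hR₀' : ∀ x, R < ‖x‖ → v₀ x = 0 ∧ v₁ x = 0 := by
    intro x hx
    have hx' : x ∉ closedBall (0 : EuclideanSpace ℝ (Fin n)) R₀ := by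
      rw [mem_closedBall_zero_iff, not_le]
      exact (le_max_left _ _).trans_lt hx
    have hx2 : x ∉ tsupport v₀ ∪ tsupport v₁ := fun h => hx' (hR₀ h)
    rw [mem_union, not_or] at hx2
    exact ⟨image_eq_zero_of_notMem_tsupport hx2.1, image_eq_zero_of_notMem_tsupport hx2.2⟩
  have hu0 : ∀ x, R < ‖x‖ → (1 + (0 : ℝ)) * v 0 x = 0 := fun x hx => by
    rw [hv0, (hR₀' x hx).1, mul_zero]
  have hut0 : ∀ x, R < ‖x‖ → (1 + (0 : ℝ)) * vt 0 x + v 0 x = 0 := fun x hx => by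
    rw [hv0, hvt0, (hR₀' x hx).1, (hR₀' x hx).2, mul_zero, add_zero]
  have hsol : IsConeSolution (EuclideanSpace.basisFun (Fin n) ℝ) p R _ _ _ _ _ _ :=
    { hJ with
      radius_nonneg := le_max_right _ _
      eqn := heqn
      supp := fun t ht x hx =>
        hJ.eq_zero_of_lt_norm heqn (exists_source_le hp hJ.cont_u) hu0 hut0 ht hx
      supp_velocity := hut0
      nonneg := fun x => by simpa [hv0] using hv₀_nonneg x
      velocity_nonneg := fun x => by
        simpa [hv0, hvt0] using add_nonneg (hv₁_nonneg x) (hv₀_nonneg x)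
      velocity_ne_zero := by
        by_contra! hz
        have hz' : ∀ x, v₀ x = 0 ∧ v₁ x = 0 := fun x => by
          have h := hz x
          simp only [hv0, hvt0, add_zero, one_mul] at h
          constructor <;> linarith [hv₀_nonneg x, hv₁_nonneg x]
        exact hne ⟨funext fun x => (hz' x).1, funext fun x => (hz' x).2⟩ }
  have : Nonempty (Fin n) := ⟨⟨0, hn⟩⟩
  have hdim : (Module.finrank ℝ (EuclideanSpace ℝ (Fin n)) : ℝ) = n := by
    rw [finrank_euclideanSpace_fin]
  by_cases hcase : (n : ℝ) * (p - 1) ≤ 2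
  · exact hsol.false_of_le_two hp (by rwa [hdim])
  · rw [not_le] at hcase
    have hquad := quadratic_nonpos_of_le_criticalExponent hn hp hp₂ hcase
    obtain ⟨hn3, hp2⟩ := three_le_and_le_two hn hp hcase hquad
    have hn3' : (3 : ℝ) ≤ n := by exact_mod_cast hn3
    refine hsol.false_of_le_strauss hp hp2 ?_ ?_ <;> rw [hdim]
    · have : 1 / p ≤ 1 := by rw [div_le_one (by linarith)]; exact hp.le
      linarith
    · have hp0 : 0 < p := by linarith
      have : ((n : ℝ) + 1) * (p - 1) / 2 - 1 / p - 1
          = (((n : ℝ) + 1) * p ^ 2 - (n + 3) * p - 2) / (2 * p) := by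
        field_simp
        ring
      have : (((n : ℝ) + 1) * p ^ 2 - (n + 3) * p - 2) / (2 * p) ≤ 0 :=
        div_nonpos_of_nonpos_of_nonneg hquad (by linarith)
      linarith
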